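/- **Notation.** A coupling of Borel probability measures $\rho^1,\rho^2$ on $\mathbb R$ is a Borel probability measure on $\mathbb R^2$ with marginals $\rho^1,\rho^2$. For $\psi:\mathbb R\to[0,+\infty]$ convex, even and lower semicontinuous, let $\mathcal C_\psi(\rho^1,\rho^2)$ be the infimum of $\int\psi(x-y)\,d\gamma(x,y)$ over all couplings $\gamma$ of $\rho^1,\rho^2$, and for $p\in[1,\infty)$ let $W_p(\rho^1,\rho^2)=\mathcal C_{|\cdot|^p}(\rho^1,\rho^2)^{1/p}$. Let $X_\rho(w)=\inf\{x:\rho((-\infty,x])>w\}$, $w\in(0,1)$, and let $\Gamma_o(\rho^1,\rho^2)$ be the image of Lebesgue measure on $(0,1)$ under $w\mapsto(X_{\rho^1}(w),X_{\rho^2}(w))$. For $\mu=(\rho,\rho v)$ and $\mu^\ell=(\rho^\ell,\rho^\ell v^\ell)$, where $v$ is the density of the second component with respect to the first, put $$U_p(\mu^1,\mu^2)=\Big(\int|v^1(x)-v^2(y)|^p\,d\Gamma_o(\rho^1,\rho^2)(x,y)\Big)^{1/p},\qquad [\mu]_p=\Big(\int(|x|^p+|v(x)|^p)\,d\rho(x)\Big)^{1/p}.$$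 **Discrete sticky-particle solutions.** Let $N$ particles have masses $m_i>0$ with $\sum_i m_i=1$, ordered positions $x_1(t)\le\dots\le x_N(t)$, continuous in $t\ge0$, and velocities $v_i(t)$ equal to the right derivative of $x_i$ at $t$. Put $J_i(t)=\{j:x_j(t)=x_i(t)\}$. They solve the sticky-particle system if each $J_i(t)$ is nondecreasing in $t$; each $v_i$ is constant on $[s,t]$ whenever $(s,t]$ contains no collision time, where a collision time is a $t>0$ at which two particles that were apart at all earlier times meet; and at each collision time $t$ the left limits $v_j(t-)$ exist and $$v_i(t)=\frac{\sum_{j\in J_i(t)}m_jv_j(t-)}{\sum_{j\in J_i(t)}m_j}\qquad\text{for all } i.$$ The corresponding discrete sticky-particle solution is the curve $\mu_t=(\rho_t,\rho_tv_t)=\big(\sum_i m_i\delta_{x_i(t)},\sum_i m_iv_i(t)\delta_{x_i(t)}\big)$, $t\ge0$. **Theorem 2.2 (stability with respect to the initial data).** There is a universal constant $C$ such that, for any two discrete sticky-particle solutions $\mu^\ell_t=(\rho^\ell_t,\rho^\ell_tv^\ell_t)$, $\ell=1,2$, and every $t\ge0$: (a) for every convex, even and lower semicontinuous $\psi:\mathbb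 R\to[0,+\infty]$, $$\mathcal C_\psi(\rho^1_t,\rho^2_t)\le\int_{\mathbb R^2}\psi\big((x+tv^1_0(x))-(y+tv^2_0(y))\big)\,d\Gamma_o(\rho^1_0,\rho^2_0)(x,y);$$ (b) for every $p\in[1,\infty)$, $$W_p(\rho^1_t,\rho^2_t)\le W_p(\rho^1_0,\rho^2_0)+t\,U_p(\mu^1_0,\mu^2_0);$$ (c) $$\int_0^tU_2(\mu^1_r,\mu^2_r)^2\,dr\le C(1+t)\big([\mu^1_0]_2+[\mu^2_0]_2\big)\big(W_2(\rho^1_0,\rho^2_0)+U_2(\mu^1_0,\mu^2_0)\big).$$ -/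

import Mathlib

open Set Filter Topology MeasureTheory
open scoped NNReal ENNReal

noncomputable section

namespace StickyParticles

/-! ### Couplings, transport costs and monotone rearrangements on the line -/

/-- Couplings of `ρ₁` and `ρ₂`: measures on `ℝ × ℝ` with marginals `ρ₁` and `ρ₂` (they are
probability measures as soon as `ρ₁` is one). -/
def couplings (ρ₁ ρ₂ : Measure ℝ) : Set (Measure (ℝ × ℝ)) :=
  {γ | γ.map Prod.fst = ρ₁ ∧ γ.map Prod.snd = ρ₂}

/-- The profile `ψ : ℝ → [0, +∞]` of an admissible cost `c(x, y) = ψ (x - y)`: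
convex, even and lower semicontinuous. -/
structure IsConvexCost (ψ : ℝ → ℝ≥0∞) : Prop where
  convex : ∀ x y a b : ℝ, 0 ≤ a → 0 ≤ b → a + b = 1 →
    ψ (a * x + b * y) ≤ ENNReal.ofReal a * ψ x + ENNReal.ofReal b * ψ y
  even : ∀ x, ψ (-x) = ψ x
  lsc : LowerSemicontinuous ψ

/-- The optimal transport cost `C_ψ(ρ₁, ρ₂)`. -/
def transportCost (ψ : ℝ → ℝ≥0∞) (ρ₁ ρ₂ : Measure ℝ) : ℝ≥0∞ :=
  ⨅ γ ∈ couplings ρ₁ ρ₂, ∫⁻ z, ψ (z.1 - z.2) ∂γ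

/-- The `L^p` Wasserstein distance. -/
def wasserstein (p : ℝ) (ρ₁ ρ₂ : Measure ℝ) : ℝ≥0∞ :=
  (transportCost (fun x => ENNReal.ofReal (|x| ^ p)) ρ₁ ρ₂) ^ (1 / p)

/-- The monotone rearrangement `X_ρ(w) = inf {x : ρ((-∞, x]) > w}`, for `w ∈ (0, 1)`. -/
def rearrangement (ρ : Measure ℝ) (w : ℝ) : ℝ :=
  sInf {x : ℝ | w < ρ.real (Iic x)}

/-- The monotone (optimal) coupling `Γ_o(ρ₁, ρ₂)`: the image of Lebesgue measure on `(0, 1)` under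
`w ↦ (X_ρ₁(w), X_ρ₂(w))`. -/
def optimalCoupling (ρ₁ ρ₂ : Measure ℝ) : Measure (ℝ × ℝ) :=
  (volume.restrict (Ioo (0 : ℝ) 1)).map (fun w => (rearrangement ρ₁ w, rearrangement ρ₂ w))

/-! ### Pairs `μ = (ρ, ρ v)` -/

/-- A pair `(ρ, ρ v)` made of a mass distribution and a momentum distribution. -/
structure PhaseState where
  density : Measure ℝ
  momentum : SignedMeasure ℝ

/-- The velocity `v` of `μ = (ρ, ρ v)`, i.e. the density of the momentum with respect to `ρ`. -/
def PhaseState.velocity (μ : PhaseState) : ℝ → ℝ :=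
  μ.momentum.rnDeriv μ.density

/-- The semidistance `U_p` between the velocities of two states. -/
def velocityDist (p : ℝ) (μ₁ μ₂ : PhaseState) : ℝ≥0∞ :=
  (∫⁻ z, ENNReal.ofReal (|μ₁.velocity z.1 - μ₂.velocity z.2| ^ p)
    ∂(optimalCoupling μ₁.density μ₂.density)) ^ (1 / p)

/-- The `p`-moment `[μ]_p = (∫ (|x|^p + |v(x)|^p) dρ)^(1/p)`. -/
def moment (p : ℝ) (μ : PhaseState) : ℝ≥0∞ :=
  (∫⁻ x, ENNReal.ofReal (|x| ^ p + |μ.velocity x| ^ p) ∂μ.density) ^ (1 / p)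

/-- The discrete state `(∑ mᵢ δ_{xᵢ}, ∑ mᵢ vᵢ δ_{xᵢ})`. -/
def discreteState {N : ℕ} (m x v : Fin N → ℝ) : PhaseState where
  density := ∑ i, ENNReal.ofReal (m i) • Measure.dirac (x i)
  momentum := ∑ i, (m i * v i) • (Measure.dirac (x i)).toSignedMeasure

/-! ### The discrete sticky particle system -/

open Classical in
/-- `J_i(t)`: the indices of the particles sharing the position of particle `i` at time `t`. -/
def cluster {N : ℕ} (x : Fin N → ℝ → ℝ) (i : Fin N) (t : ℝ) : Finset (Fin N) :=
  Finset.univ.filter fun j => x j t = x i t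

/-- The collision times: the times `t > 0` at which some particles meet, that is, at which some
`J_i` is strictly larger than it was at all earlier times. -/
def collisionTimes {N : ℕ} (x : Fin N → ℝ → ℝ) : Set ℝ :=
  {t | 0 < t ∧ ∃ i j, x i t = x j t ∧ ∀ s, 0 ≤ s → s < t → x i s ≠ x j s}

/-- A solution, for times `t ≥ 0`, of the discrete sticky particle system with `N` particles
`(mᵢ, xᵢ(t), vᵢ(t))` of total mass one. -/
structure IsStickyMotion {N : ℕ} (m : Fin N → ℝ) (x v : Fin N → ℝ → ℝ) : Prop where
  mass_pos : ∀ i, 0 < m i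
  mass_sum : ∑ i, m i = 1
  /-- the particles are ordered -/
  ordered : ∀ t, 0 ≤ t → Monotone fun i => x i t
  /-- the clusters `J_i(t)` are nondecreasing in time: particles stick under collision -/
  sticky : ∀ i s t, 0 ≤ s → s ≤ t → cluster x i s ⊆ cluster x i t
  /-- trajectories are continuous -/
  continuousOn : ∀ i, ContinuousOn (x i) (Ici 0)
  /-- `v i` is the right derivative of `x i` -/
  hasDeriv : ∀ i t, 0 ≤ t → HasDerivWithinAt (x i) (v i t) (Ici t) t
  /-- velocities are constant, and right continuous, between collision times -/
  free : ∀ i s t, 0 ≤ s → s ≤ t → Disjoint (Ioc s t) (collisionTimes x) → v i t = v i s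
  /-- at a collision time the velocity of each cluster is updated by conservation of mass and
  momentum; `w j` is the velocity of particle `j` just before the collision -/
  collision : ∀ t ∈ collisionTimes x, ∃ w : Fin N → ℝ,
    (∀ j, Tendsto (v j) (𝓝[<] t) (𝓝 (w j))) ∧
    ∀ i, v i t = (∑ j ∈ cluster x i t, m j * w j) / ∑ j ∈ cluster x i t, m j

/-- `t ↦ μ t`, `t ≥ 0`, is the curve `(ρ_t, ρ_t v_t)` of a discrete sticky particle solution
starting from the discrete datum `μ 0`. -/
def IsStickySolution (μ : ℝ → PhaseState) : Prop :=
  ∃ (N : ℕ) (m : Fin N → ℝ) (x v : Fin N → ℝ → ℝ), IsStickyMotion m x v ∧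
    ∀ t, 0 ≤ t → μ t = discreteState m (fun i => x i t) (fun i => v i t)

end StickyParticles

end

namespace StickyParticles

/-! ### Weighted rearrangement inequalities -/

/-- A finite form of Chebyshev's inequality for a symmetric nonnegative kernel. -/
theorem sum_kernel_mul_nonpos {ι : Type*} [Fintype ι] (k : ι → ι → ℝ) (w Z : ι → ℝ)
    (hsymm : ∀ i j, k i j = k j i)
    (hle : ∀ i j, k i j * ((w i - w j) * (Z i - Z j)) ≤ 0) :
    ∑ i, ∑ j, k i j * (w i - w j) * Z i ≤ 0 := by
  have h1 : ∑ i, ∑ j, k i j * (w i - w j) * Z i = ∑ i, ∑ j, k i j * (w j - w i) * Z j := by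
    rw [Finset.sum_comm]
    refine Finset.sum_congr rfl fun i _ => Finset.sum_congr rfl fun j _ => ?_
    rw [hsymm]
  have h2 : ∑ i, ∑ j, k i j * (w i - w j) * Z i + ∑ i, ∑ j, k i j * (w j - w i) * Z j ≤ 0 := by
    rw [← Finset.sum_add_distrib]
    refine Finset.sum_nonpos fun i _ => ?_
    rw [← Finset.sum_add_distrib]
    refine Finset.sum_nonpos fun j _ => ?_
    calc _ = k i j * ((w i - w j) * (Z i - Z j)) := by ring
      _ ≤ 0 := hle i j
  linarith

variable {N : ℕ} {m : Fin N → ℝ} {x v : Fin N → ℝ → ℝ}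

/-- `Z` is nondecreasing on each set of particles sharing the same position at time `t`. -/
def MonotoneOnClusters (x : Fin N → ℝ → ℝ) (t : ℝ) (Z : Fin N → ℝ) : Prop :=
  ∀ i j, i ≤ j → x i t = x j t → Z i ≤ Z j

theorem mem_cluster {i j : Fin N} {t : ℝ} : j ∈ cluster x i t ↔ x j t = x i t := by
  simp [cluster]

theorem cluster_congr {i j : Fin N} {t : ℝ} (h : x i t = x j t) :
    cluster x i t = cluster x j t := by
  ext k; rw [mem_cluster, mem_cluster, h]

theorem collisionTimes_finite (x : Fin N → ℝ → ℝ) : (collisionTimes x).Finite := by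
  refine Set.Finite.subset (s := ⋃ p : Fin N × Fin N,
    {t | 0 < t ∧ x p.1 t = x p.2 t ∧ ∀ s, 0 ≤ s → s < t → x p.1 s ≠ x p.2 s}) ?_ ?_
  · refine Set.finite_iUnion fun p => Set.Subsingleton.finite ?_
    rintro s ⟨hs0, hs, hs'⟩ t ⟨ht0, ht, ht'⟩
    rcases lt_trichotomy s t with h | h | h
    · exact absurd hs (ht' s hs0.le h)
    · exact h
    · exact absurd ht (hs' t ht0.le h)
  · rintro t ⟨h0, i, j, h1, h2⟩
    exact Set.mem_iUnion.2 ⟨(i, j), h0, h1, h2⟩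

/-- Redistributing a velocity `w` according to conservation of momentum inside each cluster
increases its product with functions that are nondecreasing on clusters where `w` is
nonincreasing. -/
theorem sum_mul_le_sum_average_mul (hm : ∀ i, 0 < m i) {t : ℝ} {w u Z : Fin N → ℝ}
    (hu : ∀ i, u i = (∑ j ∈ cluster x i t, m j * w j) / ∑ j ∈ cluster x i t, m j)
    (hw : ∀ i j, i ≤ j → x i t = x j t → w j ≤ w i) (hZ : MonotoneOnClusters x t Z) :
    ∑ i, m i * w i * Z i ≤ ∑ i, m i * u i * Z i := by
  classical
  set k : Fin N → Fin N → ℝ := fun i j =>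
    if x j t = x i t then m i * m j / ∑ l ∈ cluster x i t, m l else 0 with hk
  have hM : ∀ i, 0 < ∑ l ∈ cluster x i t, m l := fun i =>
    Finset.sum_pos (fun l _ => hm l) ⟨i, mem_cluster.2 rfl⟩
  have key : ∑ i, ∑ j, k i j * (w i - w j) * Z i ≤ 0 := by
    refine sum_kernel_mul_nonpos k w Z (fun i j => ?_) fun i j => ?_
    · by_cases h : x j t = x i t
      · simp only [hk, h, if_true, cluster_congr h]
        ring
      · simp only [hk, h, if_false, Ne.symm h]
    · by_cases h : x j t = x i t
      · simp only [hk, h, if_true]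
        refine mul_nonpos_of_nonneg_of_nonpos
          (div_nonneg (mul_pos (hm i) (hm j)).le (hM i).le) ?_
        rcases le_total i j with hij | hij
        · exact mul_nonpos_of_nonneg_of_nonpos (sub_nonneg.2 (hw i j hij h.symm))
            (sub_nonpos.2 (hZ i j hij h.symm))
        · exact mul_nonpos_of_nonpos_of_nonneg (sub_nonpos.2 (hw j i hij h))
            (sub_nonneg.2 (hZ j i hij h))
      · simp [hk, h]
  have hid : ∀ i, ∑ j, k i j * (w i - w j) * Z i = m i * w i * Z i - m i * u i * Z i := by
    intro i
    have h1 : ∀ j, k i j * (w i - w j) * Z i =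
        if x j t = x i t then
          (m i * w i * Z i / ∑ l ∈ cluster x i t, m l) * m j -
            (m i * Z i / ∑ l ∈ cluster x i t, m l) * (m j * w j) else 0 := by
      intro j
      by_cases h : x j t = x i t
      · simp only [hk, h, if_true]; ring
      · simp [hk, h]
    rw [Finset.sum_congr rfl fun j _ => h1 j, ← Finset.sum_filter]
    have h2 : (Finset.univ.filter fun j => x j t = x i t) = cluster x i t := by
      ext; simp [cluster]
    rw [h2, Finset.sum_sub_distrib, ← Finset.mul_sum, ← Finset.mul_sum, hu i]
    have := (hM i).ne'
    field_simp
  rw [Finset.sum_congr rfl fun i _ => hid i, Finset.sum_sub_distrib] at key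
  linarith

namespace IsStickyMotion

theorem eq_of_eq (h : IsStickyMotion m x v) {i j : Fin N} {s t : ℝ} (hs : 0 ≤ s) (hst : s ≤ t)
    (hij : x i s = x j s) : x i t = x j t :=
  mem_cluster.1 (h.sticky j s t hs hst (mem_cluster.2 hij))

theorem velocity_eq_of_eq (h : IsStickyMotion m x v) {i j : Fin N} {t : ℝ} (ht : 0 ≤ t)
    (hij : x i t = x j t) : v i t = v j t := by
  refine (uniqueDiffWithinAt_Ici t).eq_deriv _ (h.hasDeriv i t ht)
    ((h.hasDeriv j t ht).congr (fun s hs => ?_) hij)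
  exact h.eq_of_eq ht hs hij

theorem monotoneOnClusters_mono (h : IsStickyMotion m x v) {s t : ℝ} (hs : 0 ≤ s) (hst : s ≤ t)
    {Z : Fin N → ℝ} (hZ : MonotoneOnClusters x t Z) : MonotoneOnClusters x s Z :=
  fun i j hij hx => hZ i j hij (h.eq_of_eq hs hst hx)

/-- Just before a positive time the motion is free. -/
theorem exists_free_left (h : IsStickyMotion m x v) {a t : ℝ} (ha : 0 ≤ a) (hat : a < t) :
    ∃ r, a ≤ r ∧ r < t ∧ (∀ i, ∀ s ∈ Ico r t, v i s = v i r) ∧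
      ∀ i, x i t = x i r + v i r * (t - r) := by
  obtain ⟨r, hr, hrt, hdis⟩ : ∃ r, a ≤ r ∧ r < t ∧ Disjoint (Ioo r t) (collisionTimes x) := by
    have hfin : (collisionTimes x ∩ Iio t).Finite := (collisionTimes_finite x).inter_of_left _
    have hev : ∀ᶠ r in 𝓝[<] t, ∀ c ∈ collisionTimes x ∩ Iio t, c < r := by
      rw [Filter.eventually_all_finite hfin]
      intro c hc
      exact Filter.mem_of_superset (Ioo_mem_nhdsLT hc.2) fun y hy => hy.1
    have hev2 : ∀ᶠ r in 𝓝[<] t, a ≤ r ∧ r < t := by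
      filter_upwards [Ioo_mem_nhdsLT hat] with y hy using ⟨hy.1.le, hy.2⟩
    obtain ⟨r, hr1, hr2, hr3⟩ := (hev.and hev2).exists
    refine ⟨r, hr2, hr3, Set.disjoint_left.2 fun c hc hc' => ?_⟩
    exact lt_asymm (hr1 c ⟨hc', hc.2⟩) hc.1
  have hconst : ∀ i, ∀ s ∈ Ico r t, v i s = v i r := fun i s hs =>
    h.free i r s (ha.trans hr) hs.1 (hdis.mono_left (Ioc_subset_Ioo_right hs.2))
  refine ⟨r, hr, hrt, hconst, fun i => ?_⟩
  have hc := constant_of_has_deriv_right_zero (f := fun s => x i s - v i r * s) (a := r) (b := t)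
    (((h.continuousOn i).mono fun y hy => (ha.trans hr).trans hy.1).sub (by fun_prop))
    (fun s hs => by
      have h1 := h.hasDeriv i s ((ha.trans hr).trans hs.1)
      rw [hconst i s hs] at h1
      simpa using h1.fun_sub ((hasDerivWithinAt_id s (Ici s)).const_mul (v i r)))
    t ⟨hrt.le, le_rfl⟩
  linarith

/-- The momentum tested against a function that is nondecreasing on the clusters increases at a
collision. -/
theorem exists_momentum_le_of_collision (h : IsStickyMotion m x v) {a t : ℝ} (ha : 0 ≤ a)
    (hat : a < t) (htc : t ∈ collisionTimes x) {Z : Fin N → ℝ} (hZ : MonotoneOnClusters x t Z) :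
    ∃ r, a ≤ r ∧ r < t ∧ ∑ i, m i * v i r * Z i ≤ ∑ i, m i * v i t * Z i := by
  obtain ⟨r, har, hrt, hconst, hx⟩ := h.exists_free_left ha hat
  obtain ⟨w, hw, hv⟩ := h.collision t htc
  have hwr : ∀ i, w i = v i r := fun i => by
    refine tendsto_nhds_unique (hw i) (tendsto_const_nhds.congr' ?_)
    exact Filter.mem_of_superset (Ioo_mem_nhdsLT hrt) fun s hs =>
      (hconst i s ⟨hs.1.le, hs.2⟩).symm
  refine ⟨r, har, hrt, sum_mul_le_sum_average_mul h.mass_pos (t := t) (x := x) (fun i => ?_)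
    (fun i j hij hxij => ?_) hZ⟩
  · simp only [← hwr]
    exact hv i
  · have h1 := h.ordered r (ha.trans har) hij
    simp only at h1
    rw [hx i, hx j] at hxij
    have h2 : (v j r - v i r) * (t - r) ≤ 0 := by linarith
    have h3 : 0 < t - r := sub_pos.2 hrt
    nlinarith [nonpos_of_mul_nonpos_left h2 h3]

/-- The momentum tested against a function that is nondecreasing on the clusters at the final time
is nondecreasing in time. -/
theorem momentum_le (h : IsStickyMotion m x v) {s t : ℝ} (hs : 0 ≤ s) (hst : s ≤ t)
    {Z : Fin N → ℝ} (hZ : MonotoneOnClusters x t Z) :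
    ∑ i, m i * v i s * Z i ≤ ∑ i, m i * v i t * Z i := by
  have hfin : ∀ t, (collisionTimes x ∩ Ioc s t).Finite := fun t =>
    (collisionTimes_finite x).inter_of_left _
  induction hn : (hfin t).toFinset.card using Nat.strong_induction_on generalizing t with
  | _ n ih =>
    by_cases hne : (hfin t).toFinset.Nonempty
    · set c := (hfin t).toFinset.max' hne with hc
      have hcm : c ∈ collisionTimes x ∩ Ioc s t := (hfin t).mem_toFinset.1 (Finset.max'_mem _ hne)
      have hvt : ∀ i, v i t = v i c := fun i => by
        refine h.free i c t (hs.trans hcm.2.1.le) hcm.2.2 (Set.disjoint_left.2 fun d hd hd' => ?_)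
        exact absurd ((hfin t).toFinset.le_max' d
          ((hfin t).mem_toFinset.2 ⟨hd', hcm.2.1.trans hd.1, hd.2⟩)) (not_le.2 hd.1)
      have hZc := h.monotoneOnClusters_mono (hs.trans hcm.2.1.le) hcm.2.2 hZ
      obtain ⟨r, hsr, hrc, hr⟩ := h.exists_momentum_le_of_collision hs hcm.2.1 hcm.1 hZc
      refine (ih _ ?_ hsr (h.monotoneOnClusters_mono (hs.trans hsr) hrc.le hZc) rfl).trans ?_
      · rw [← hn]
        refine Finset.card_lt_card ((Finset.ssubset_iff_of_subset fun d hd => ?_).2 ⟨c, ?_, ?_⟩)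
        · rw [Set.Finite.mem_toFinset] at hd ⊢
          exact ⟨hd.1, hd.2.1, hd.2.2.trans (hrc.le.trans hcm.2.2)⟩
        · exact (hfin t).mem_toFinset.2 hcm
        · rw [Set.Finite.mem_toFinset]
          exact fun hd => absurd hd.2.2 (not_le.2 hrc)
      · simpa only [hvt] using hr
    · have hvt : ∀ i, v i t = v i s := fun i => by
        refine h.free i s t hs hst (Set.disjoint_left.2 fun d hd hd' => ?_)
        exact hne ⟨d, (hfin t).mem_toFinset.2 ⟨hd', hd⟩⟩
      simp only [hvt, le_refl]

theorem momentum_eq (h : IsStickyMotion m x v) {s t : ℝ} (hs : 0 ≤ s) (hst : s ≤ t)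
    {Z : Fin N → ℝ} (hZ : ∀ i j, x i t = x j t → Z i = Z j) :
    ∑ i, m i * v i s * Z i = ∑ i, m i * v i t * Z i := by
  refine le_antisymm (h.momentum_le hs hst fun i j _ hij => (hZ i j hij).le) ?_
  have := h.momentum_le hs hst (Z := fun i => - Z i) fun i j _ hij => (neg_le_neg (hZ i j hij).ge)
  simpa only [mul_neg, Finset.sum_neg_distrib, neg_le_neg_iff] using this

/-- The position at time `t` is the projection of the free motion on the cone of nondecreasing
configurations. -/
theorem sum_free_sub_mul_nonpos (h : IsStickyMotion m x v) {t : ℝ} (ht : 0 ≤ t)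
    {Z : Fin N → ℝ} (hZ : MonotoneOnClusters x t Z) :
    ∑ i, m i * (x i 0 + t * v i 0 - x i t) * Z i ≤ 0 := by
  have key := image_le_of_deriv_right_le_deriv_boundary (a := 0) (b := t)
    (f := fun s => ∑ i, m i * (x i 0 + s * v i 0 - x i s) * Z i)
    (f' := fun s => ∑ i, m i * (v i 0 - v i s) * Z i)
    (B := fun _ => 0) (B' := fun _ => 0) ?_ ?_ (by simp) continuousOn_const
    (fun s _ => hasDerivWithinAt_const _ _ _) ?_ ⟨ht, le_rfl⟩
  · simpa using key
  · refine continuousOn_finsetSum _ fun i _ => ?_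
    have := (h.continuousOn i).mono (Icc_subset_Ici_self : Icc 0 t ⊆ Ici 0)
    fun_prop
  · intro s hs
    refine HasDerivWithinAt.fun_sum fun i _ => ?_
    refine HasDerivWithinAt.mul_const ?_ _
    refine HasDerivWithinAt.const_mul _ ?_
    refine HasDerivWithinAt.sub ?_ (h.hasDeriv i s hs.1)
    simpa using ((hasDerivWithinAt_id s (Ici s)).mul_const (v i 0)).const_add (x i 0)
  · intro s hs
    have := h.momentum_le le_rfl hs.1 (h.monotoneOnClusters_mono hs.1 hs.2.le hZ)
    have h2 : ∑ i, m i * (v i 0 - v i s) * Z i =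
      ∑ i, m i * v i 0 * Z i - ∑ i, m i * v i s * Z i := by
      rw [← Finset.sum_sub_distrib]
      exact Finset.sum_congr rfl fun i _ => by ring
    simp only [h2]
    linarith

end IsStickyMotion

/-! ### Contraction of the sticky particle map with respect to convex costs -/

/-- The right derivative of a convex function is a subgradient. -/
theorem _root_.ConvexOn.add_rightDeriv_mul_sub_le {S : Set ℝ} {g : ℝ → ℝ} (hg : ConvexOn ℝ S g)
    {d y : ℝ} (hd : d ∈ interior S) (hy : y ∈ S) :
    g d + derivWithin g (Ioi d) d * (y - d) ≤ g y := by
  rcases lt_trichotomy d y with h | h | h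
  · have := hg.rightDeriv_le_slope_of_mem_interior hd hy h
    rw [slope_def_field, le_div_iff₀ (sub_pos.2 h)] at this
    linarith
  · simp [h]
  · have := (hg.slope_le_leftDeriv_of_mem_interior hy hd h).trans
      (hg.leftDeriv_le_rightDeriv_of_mem_interior hd)
    rw [slope_def_field, div_le_iff₀ (sub_pos.2 h)] at this
    linarith

variable {N : ℕ} {m : Fin N → ℝ} {x₁ v₁ x₂ v₂ : Fin N → ℝ → ℝ}

theorem IsStickyMotion.sum_convexOn_le (h₁ : IsStickyMotion m x₁ v₁) (h₂ : IsStickyMotion m x₂ v₂)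
    {t : ℝ} (ht : 0 ≤ t) {S : Set ℝ} {g : ℝ → ℝ} (hg : ConvexOn ℝ S g)
    (hD : ∀ i, x₁ i t - x₂ i t ∈ interior S)
    (hY : ∀ i, (x₁ i 0 + t * v₁ i 0) - (x₂ i 0 + t * v₂ i 0) ∈ S) :
    ∑ i, m i * g (x₁ i t - x₂ i t) ≤
      ∑ i, m i * g ((x₁ i 0 + t * v₁ i 0) - (x₂ i 0 + t * v₂ i 0)) := by
  set f : ℝ → ℝ := fun d => derivWithin g (Ioi d) d with hf
  have hmono : ∀ i j, x₁ i t - x₂ i t ≤ x₁ j t - x₂ j t →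
      f (x₁ i t - x₂ i t) ≤ f (x₁ j t - x₂ j t) := fun i j hij =>
    hg.monotoneOn_rightDeriv (hD i) (hD j) hij
  have e1 := h₁.sum_free_sub_mul_nonpos ht (Z := fun i => - f (x₁ i t - x₂ i t))
    fun i j hij hx => neg_le_neg (hmono j i (by have := h₂.ordered t ht hij; simp only at this; linarith))
  have e2 := h₂.sum_free_sub_mul_nonpos ht (Z := fun i => f (x₁ i t - x₂ i t))
    fun i j hij hx => (hmono i j (by have := h₁.ordered t ht hij; simp only at this; linarith))
  have e3 : ∑ i, m i * (g (x₁ i t - x₂ i t) + f (x₁ i t - x₂ i t) *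
      ((x₁ i 0 + t * v₁ i 0) - (x₂ i 0 + t * v₂ i 0) - (x₁ i t - x₂ i t))) ≤
      ∑ i, m i * g ((x₁ i 0 + t * v₁ i 0) - (x₂ i 0 + t * v₂ i 0)) :=
    Finset.sum_le_sum fun i _ => mul_le_mul_of_nonneg_left
      (hg.add_rightDeriv_mul_sub_le (hD i) (hY i)) (h₁.mass_pos i).le
  have e4 : ∑ i, m i * (g (x₁ i t - x₂ i t) + f (x₁ i t - x₂ i t) *
      ((x₁ i 0 + t * v₁ i 0) - (x₂ i 0 + t * v₂ i 0) - (x₁ i t - x₂ i t))) =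
      ∑ i, m i * g (x₁ i t - x₂ i t)
      - ∑ i, m i * (x₁ i 0 + t * v₁ i 0 - x₁ i t) * - f (x₁ i t - x₂ i t)
      - ∑ i, m i * (x₂ i 0 + t * v₂ i 0 - x₂ i t) * f (x₁ i t - x₂ i t) := by
    rw [← Finset.sum_sub_distrib, ← Finset.sum_sub_distrib]
    exact Finset.sum_congr rfl fun i _ => by ring
  linarith

namespace IsConvexCost

variable {ψ : ℝ → ℝ≥0∞}

theorem mul_le (hψ : IsConvexCost ψ) {l : ℝ} (h0 : 0 ≤ l) (h1 : l ≤ 1) (y : ℝ) :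
    ψ (l * y) ≤ ψ y := by
  have := hψ.convex y (-y) ((1 + l) / 2) ((1 - l) / 2) (by linarith) (by linarith) (by ring)
  rw [hψ.even, ← add_mul, ← ENNReal.ofReal_add (by linarith) (by linarith)] at this
  convert this using 1
  · congr 1; ring
  · rw [show (1 + l) / 2 + (1 - l) / 2 = 1 by ring]; simp

theorem abs_eq (hψ : IsConvexCost ψ) (y : ℝ) : ψ |y| = ψ y := by
  rcases abs_choice y with h | h <;> rw [h]
  exact hψ.even y

theorem le_of_abs_le (hψ : IsConvexCost ψ) {y z : ℝ} (h : |y| ≤ |z|) : ψ y ≤ ψ z := by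
  rcases eq_or_lt_of_le (abs_nonneg z) with hz | hz
  · rw [← hz] at h
    rw [abs_nonpos_iff.1 h, abs_eq_zero.1 hz.symm]
  · rw [← hψ.abs_eq y, ← hψ.abs_eq z]
    have := hψ.mul_le (l := |y| / |z|) (by positivity) ((div_le_one hz).2 h) |z|
    rwa [div_mul_cancel₀ _ hz.ne'] at this

theorem convexOn_toReal (hψ : IsConvexCost ψ) {R : ℝ} (hR : ψ R ≠ ⊤) (l : ℝ) :
    ConvexOn ℝ {y | |l * y| ≤ |R|} fun y => (ψ (l * y)).toReal := by
  have hfin : ∀ y, |l * y| ≤ |R| → ψ (l * y) ≠ ⊤ := fun y hy =>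
    ne_top_of_le_ne_top hR (hψ.le_of_abs_le hy)
  refine ⟨fun y hy z hz a b ha hb hab => ?_, fun y hy z hz a b ha hb hab => ?_⟩
  · have e : l * (a • y + b • z) = a * (l * y) + b * (l * z) := by simp only [smul_eq_mul]; ring
    simp only [Set.mem_ofPred_eq] at hy hz ⊢
    rw [e]
    calc _ ≤ |a * (l * y)| + |b * (l * z)| := abs_add_le _ _
      _ = a * |l * y| + b * |l * z| := by rw [abs_mul a, abs_mul b, abs_of_nonneg ha, abs_of_nonneg hb]
      _ ≤ a * |R| + b * |R| := by gcongr
      _ = |R| := by rw [← add_mul, hab, one_mul]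
  · have e : l * (a • y + b • z) = a * (l * y) + b * (l * z) := by simp only [smul_eq_mul]; ring
    have h := hψ.convex (l * y) (l * z) a b ha hb hab
    have h1 := ENNReal.mul_ne_top (ENNReal.ofReal_ne_top (r := a)) (hfin y hy)
    have h2 := ENNReal.mul_ne_top (ENNReal.ofReal_ne_top (r := b)) (hfin z hz)
    have h3 := ENNReal.toReal_mono (ENNReal.add_ne_top.2 ⟨h1, h2⟩) h
    simp only [e]
    rw [ENNReal.toReal_add h1 h2, ENNReal.toReal_mul, ENNReal.toReal_mul,
      ENNReal.toReal_ofReal ha, ENNReal.toReal_ofReal hb] at h3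
    simpa using h3

/-- A convex cost is determined at a point by its values along the segment towards the origin. -/
theorem sum_le_of_forall_mul_le (hψ : IsConvexCost ψ) {ι : Type*} (s : Finset ι) (c : ι → ℝ)
    (d : ι → ℝ) {R : ℝ≥0∞}
    (h : ∀ l : ℝ, 0 < l → l < 1 → ∑ i ∈ s, ENNReal.ofReal (c i) * ψ (l * d i) ≤ R) :
    ∑ i ∈ s, ENNReal.ofReal (c i) * ψ (d i) ≤ R := by
  have hlsc : LowerSemicontinuous fun l : ℝ => ∑ i ∈ s, ENNReal.ofReal (c i) * ψ (l * d i) := by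
    refine lowerSemicontinuous_sum fun i _ => ?_
    refine Continuous.comp_lowerSemicontinuous (g := fun y => ENNReal.ofReal (c i) * y)
      (ENNReal.continuous_const_mul ENNReal.ofReal_ne_top)
      (hψ.lsc.comp (continuous_mul_const (d i))) fun a b hab => by dsimp only; gcongr
  by_contra! hlt
  have hlt' : R < ∑ i ∈ s, ENNReal.ofReal (c i) * ψ (1 * d i) := by simpa using hlt
  have hev := (hlsc 1 R hlt').filter_mono (nhdsWithin_le_nhds (s := Iio 1))
  have hev2 : ∀ᶠ l : ℝ in 𝓝[<] 1, 0 < l ∧ l < 1 := Ioo_mem_nhdsLT one_pos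
  obtain ⟨l, h1, h2, h3⟩ := (hev.and hev2).exists
  exact absurd (h l h2 h3) (not_le.2 h1)

end IsConvexCost

theorem IsStickyMotion.abs_sub_le (h₁ : IsStickyMotion m x₁ v₁) (h₂ : IsStickyMotion m x₂ v₂)
    {t : ℝ} (ht : 0 ≤ t) {R : ℝ}
    (hY : ∀ i, |(x₁ i 0 + t * v₁ i 0) - (x₂ i 0 + t * v₂ i 0)| ≤ R) (i : Fin N) :
    |x₁ i t - x₂ i t| ≤ R := by
  have hg : ConvexOn ℝ Set.univ fun y : ℝ => max (|y| - R) 0 := by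
    have h1 : ConvexOn ℝ Set.univ fun y : ℝ => |y| - R :=
      (convexOn_norm (E := ℝ) convex_univ).sub (concaveOn_const R convex_univ)
    exact h1.sup (convexOn_const 0 convex_univ)
  have h := h₁.sum_convexOn_le h₂ ht hg (by simp) (by simp)
  have h0 : ∑ i, m i * max (|(x₁ i 0 + t * v₁ i 0) - (x₂ i 0 + t * v₂ i 0)| - R) 0 = 0 :=
    Finset.sum_eq_zero fun i _ => by rw [max_eq_right (sub_nonpos.2 (hY i)), mul_zero]
  have hnn : ∀ j ∈ Finset.univ, 0 ≤ m j * max (|x₁ j t - x₂ j t| - R) 0 := fun j _ =>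
    mul_nonneg (h₁.mass_pos j).le (le_max_right _ _)
  have h1 := (Finset.sum_eq_zero_iff_of_nonneg hnn).1
    (le_antisymm (h.trans h0.le) (Finset.sum_nonneg hnn)) i (Finset.mem_univ i)
  have h2 := (mul_eq_zero.1 h1).resolve_left (h₁.mass_pos i).ne'
  have := le_max_left (|x₁ i t - x₂ i t| - R) 0
  linarith

theorem IsStickyMotion.sum_cost_le (h₁ : IsStickyMotion m x₁ v₁) (h₂ : IsStickyMotion m x₂ v₂)
    {t : ℝ} (ht : 0 ≤ t) {ψ : ℝ → ℝ≥0∞} (hψ : IsConvexCost ψ) :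
    ∑ i, ENNReal.ofReal (m i) * ψ (x₁ i t - x₂ i t) ≤
      ∑ i, ENNReal.ofReal (m i) * ψ ((x₁ i 0 + t * v₁ i 0) - (x₂ i 0 + t * v₂ i 0)) := by
  set Y : Fin N → ℝ := fun i => (x₁ i 0 + t * v₁ i 0) - (x₂ i 0 + t * v₂ i 0) with hYdef
  have hne : (Finset.univ : Finset (Fin N)).Nonempty := by
    by_contra hcon
    have := h₁.mass_sum
    rw [Finset.not_nonempty_iff_eq_empty.1 hcon] at this
    simp at this
  by_cases htop : ∃ i, ψ (Y i) = ⊤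
  · obtain ⟨i, hi⟩ := htop
    refine le_top.trans (top_le_iff.2 ?_).ge
    rw [ENNReal.sum_eq_top]
    refine ⟨i, Finset.mem_univ i, ?_⟩
    have hi' : ψ ((x₁ i 0 + t * v₁ i 0) - (x₂ i 0 + t * v₂ i 0)) = ⊤ := hi
    rw [hi', ENNReal.mul_top (by simpa using h₁.mass_pos i)]
  push Not at htop
  obtain ⟨k, -, hk⟩ := Finset.exists_max_image Finset.univ (fun i => |Y i|) hne
  have hD := h₁.abs_sub_le h₂ ht (R := |Y k|) fun i => hk i (Finset.mem_univ i)
  refine hψ.sum_le_of_forall_mul_le _ _ _ fun l hl0 hl1 => ?_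
  have hfinY : ∀ i, ψ (l * Y i) ≠ ⊤ := fun i =>
    ne_top_of_le_ne_top (htop i) (hψ.mul_le hl0.le hl1.le _)
  have habs : ∀ y, |y| ≤ |Y k| → |l * y| ≤ |Y k| := fun y hy => by
    rw [abs_mul, abs_of_pos hl0]
    exact (mul_le_of_le_one_left (abs_nonneg y) hl1.le).trans hy
  have hfinD : ∀ i, ψ (l * (x₁ i t - x₂ i t)) ≠ ⊤ := fun i =>
    ne_top_of_le_ne_top (htop k) (hψ.le_of_abs_le (habs _ (hD i)))
  have key : ∑ i, m i * (ψ (l * (x₁ i t - x₂ i t))).toReal ≤ ∑ i, m i * (ψ (l * Y i)).toReal := by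
    rcases eq_or_lt_of_le (abs_nonneg (Y k)) with h0 | h0
    · refine (Finset.sum_congr rfl fun i _ => ?_).le
      have h1 : |Y i| ≤ 0 := h0 ▸ hk i (Finset.mem_univ i)
      rw [abs_nonpos_iff.1 (h0 ▸ hD i : |x₁ i t - x₂ i t| ≤ 0), abs_nonpos_iff.1 h1]
    · refine h₁.sum_convexOn_le h₂ ht (hψ.convexOn_toReal (htop k) l) (fun i => ?_)
        fun i => habs _ (hk i (Finset.mem_univ i))
      refine interior_maximal (t := {y | |l * y| < |Y k|}) (fun y (hy : |l * y| < |Y k|) => hy.le)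
        (isOpen_lt (by fun_prop) continuous_const) ?_
      simp only [Set.mem_ofPred_eq]
      rw [abs_mul, abs_of_pos hl0]
      nlinarith [hD i, abs_nonneg (x₁ i t - x₂ i t)]
  have conv : ∀ c : Fin N → ℝ, (∀ i, ψ (c i) ≠ ⊤) →
      ∑ i, ENNReal.ofReal (m i) * ψ (c i) = ENNReal.ofReal (∑ i, m i * (ψ (c i)).toReal) := by
    intro c hc
    rw [ENNReal.ofReal_sum_of_nonneg
      fun i _ => mul_nonneg (h₁.mass_pos i).le ENNReal.toReal_nonneg]
    refine Finset.sum_congr rfl fun i _ => ?_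
    rw [ENNReal.ofReal_mul (h₁.mass_pos i).le, ENNReal.ofReal_toReal (hc i)]
  rw [conv _ hfinD]
  refine (ENNReal.ofReal_le_ofReal key).trans ?_
  rw [← conv _ hfinY]
  exact Finset.sum_le_sum fun i _ => by gcongr; exact hψ.mul_le hl0.le hl1.le _

/-! ### Stability of the velocities in a Hilbert space -/

theorem lintegral_le_of_hasDeriv_right {F F' f : ℝ → ℝ} {t : ℝ} (ht : 0 ≤ t)
    (hcont : ContinuousOn F (Icc 0 t))
    (hderiv : ∀ r ∈ Ioo 0 t, HasDerivWithinAt F (F' r) (Ici r) r)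
    (hf : ∀ r ∈ Ioo 0 t, 0 ≤ f r ∧ f r ≤ F' r) :
    ∫⁻ r in Ioc 0 t, ENNReal.ofReal (f r) ≤ ENNReal.ofReal (F t - F 0) := by
  have hd : ∀ r ∈ Ioo 0 t, HasDerivWithinAt F (F' r) (Ioi r) r := fun r hr =>
    (hderiv r hr).Ioi_of_Ici
  have hpos : ∀ r ∈ Ioo 0 t, 0 ≤ F' r := fun r hr => (hf r hr).1.trans (hf r hr).2
  have hint := intervalIntegral.integrableOn_deriv_right_of_nonneg hcont hd hpos
  have hFTC := intervalIntegral.integral_eq_sub_of_hasDeriv_right_of_le ht hcont hd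
    ((intervalIntegrable_iff_integrableOn_Ioc_of_le ht).2 hint)
  rw [intervalIntegral.integral_of_le ht, integral_Ioc_eq_integral_Ioo] at hFTC
  rw [← restrict_Ioo_eq_restrict_Ioc, ← hFTC, ofReal_integral_eq_lintegral_ofReal
    (hint.mono_set Ioo_subset_Ioc_self)
    ((ae_restrict_iff' measurableSet_Ioo).2 (Eventually.of_forall hpos))]
  exact setLIntegral_mono_ae' measurableSet_Ioo
    (Eventually.of_forall fun r hr => ENNReal.ofReal_le_ofReal (hf r hr).2)

variable {H : Type*} [NormedAddCommGroup H] [InnerProductSpace ℝ H]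

/-- A curve whose velocity at each time is the projection of all earlier velocities on a subspace
that contains the current position. -/
structure IsProjectedCurve (X V : ℝ → H) : Prop where
  continuousOn : ContinuousOn X (Ici 0)
  hasDeriv : ∀ t, 0 ≤ t → HasDerivWithinAt X (V t) (Ici t) t
  inner_velocity : ∀ s t, 0 ≤ s → s ≤ t → inner ℝ (V s - V t) (V t) = 0
  inner_position : ∀ s t, 0 ≤ s → s ≤ t → inner ℝ (V s - V t) (X t) = 0

namespace IsProjectedCurve

variable {X V X₁ V₁ X₂ V₂ : ℝ → H}

theorem inner_eq (hX : IsProjectedCurve X V) {s t : ℝ} (hs : 0 ≤ s) (hst : s ≤ t) :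
    inner ℝ (V s) (V t) = ‖V t‖ ^ 2 := by
  have := hX.inner_velocity s t hs hst
  rw [inner_sub_left, real_inner_self_eq_norm_sq] at this
  linarith

theorem norm_sub_sq_eq (hX : IsProjectedCurve X V) {s t : ℝ} (hs : 0 ≤ s) (hst : s ≤ t) :
    ‖V s - V t‖ ^ 2 = ‖V s‖ ^ 2 - ‖V t‖ ^ 2 := by
  rw [norm_sub_sq_real, hX.inner_eq hs hst]
  ring

theorem norm_sq_le (hX : IsProjectedCurve X V) {s t : ℝ} (hs : 0 ≤ s) (hst : s ≤ t) :
    ‖V t‖ ^ 2 ≤ ‖V s‖ ^ 2 := by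
  have := hX.norm_sub_sq_eq hs hst
  nlinarith [sq_nonneg ‖V s - V t‖]

theorem norm_le (hX : IsProjectedCurve X V) {s t : ℝ} (hs : 0 ≤ s) (hst : s ≤ t) :
    ‖V t‖ ≤ ‖V s‖ :=
  le_of_sq_le_sq (hX.norm_sq_le hs hst) (norm_nonneg _)

theorem hasDeriv_inner (hX : IsProjectedCurve X V) (z : H) {t : ℝ} (ht : 0 ≤ t) :
    HasDerivWithinAt (fun s => inner ℝ z (X s)) (inner ℝ z (V t)) (Ici t) t := by
  simpa using (hasDerivWithinAt_const t (Ici t) z).inner ℝ (hX.hasDeriv t ht)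

theorem continuousOn_inner (hX : IsProjectedCurve X V) (z : H) :
    ContinuousOn (fun s => inner ℝ z (X s)) (Ici 0) :=
  continuousOn_const.inner hX.continuousOn

/-- An affine upper bound for a scalar product with the positions. -/
theorem inner_le_add_mul (hX : IsProjectedCurve X V) (z : H) {a b c : ℝ} (ha : 0 ≤ a) (hab : a ≤ b)
    (hc : ∀ s, a ≤ s → s < b → inner ℝ z (V s) ≤ c) :
    inner ℝ z (X b) ≤ inner ℝ z (X a) + c * (b - a) := by
  refine image_le_of_deriv_right_le_deriv_boundary (a := a) (b := b)
    (f := fun s => inner ℝ z (X s)) (f' := fun s => inner ℝ z (V s))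
    (B := fun s => inner ℝ z (X a) + c * (s - a)) (B' := fun _ => c)
    ((hX.continuousOn_inner z).mono fun s hs => ha.trans hs.1)
    (fun s hs => hX.hasDeriv_inner z (ha.trans hs.1)) (by simp) (by fun_prop) (fun s _ => ?_)
    (fun s hs => hc s hs.1 hs.2) ⟨hab, le_rfl⟩
  simpa using (((hasDerivWithinAt_id s (Ici s)).sub_const a).const_mul c).const_add (inner ℝ z (X a))

/-- The position stays on the nonpositive side of the free motion. -/
theorem inner_free_sub_nonneg (hX : IsProjectedCurve X V) (z : H) {t : ℝ} (ht : 0 ≤ t)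
    (hz : ∀ s, 0 ≤ s → s < t → 0 ≤ inner ℝ (V 0 - V s) z) :
    0 ≤ inner ℝ (X 0 + t • V 0 - X t) z := by
  have := hX.inner_le_add_mul z (c := inner ℝ z (V 0)) le_rfl ht fun s hs hst => by
    have := hz s hs hst
    rw [inner_sub_left, real_inner_comm z, real_inner_comm z] at this
    linarith
  rw [inner_sub_left, inner_add_left, inner_smul_left, real_inner_comm z, real_inner_comm z,
    real_inner_comm z]
  simp
  linarith

theorem norm_sub_le (h₁ : IsProjectedCurve X₁ V₁) (h₂ : IsProjectedCurve X₂ V₂)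
    (h₁₂ : ∀ r s, 0 ≤ r → 0 ≤ s → inner ℝ (V₁ 0 - V₁ r) (X₂ s) ≤ 0)
    (h₂₁ : ∀ r s, 0 ≤ r → 0 ≤ s → inner ℝ (V₂ 0 - V₂ r) (X₁ s) ≤ 0) {t : ℝ} (ht : 0 ≤ t) :
    ‖X₁ t - X₂ t‖ ≤ ‖X₁ 0 - X₂ 0‖ + t * ‖V₁ 0 - V₂ 0‖ := by
  have orth : ∀ {X V : ℝ → H}, IsProjectedCurve X V → ∀ s, 0 ≤ s → s < t →
      inner ℝ (V 0 - V s) (X t) = 0 := fun {X V} h s hs hst => by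
    have e1 := h.inner_position 0 t le_rfl ht
    have e2 := h.inner_position s t hs hst.le
    rw [inner_sub_left] at e1 e2 ⊢
    linarith
  have a1 := h₁.inner_free_sub_nonneg (X₁ t - X₂ t) ht fun s hs hst => by
    rw [inner_sub_right, orth h₁ s hs hst]
    linarith [h₁₂ s t hs ht]
  have a2 := h₂.inner_free_sub_nonneg (X₂ t - X₁ t) ht fun s hs hst => by
    rw [inner_sub_right, orth h₂ s hs hst]
    linarith [h₂₁ s t hs ht]
  set D := X₁ t - X₂ t with hD
  have e : inner ℝ ((X₁ 0 - X₂ 0) + t • (V₁ 0 - V₂ 0)) D = ‖D‖ ^ 2 +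
      inner ℝ (X₁ 0 + t • V₁ 0 - X₁ t) D + inner ℝ (X₂ 0 + t • V₂ 0 - X₂ t) (X₂ t - X₁ t) := by
    rw [← real_inner_self_eq_norm_sq, show X₂ t - X₁ t = -D by rw [hD]; abel, inner_neg_right,
      ← inner_add_left, ← sub_eq_add_neg, ← inner_sub_left]
    congr 1
    rw [hD, smul_sub]
    abel
  have cs := real_inner_le_norm ((X₁ 0 - X₂ 0) + t • (V₁ 0 - V₂ 0)) D
  have n1 : ‖(X₁ 0 - X₂ 0) + t • (V₁ 0 - V₂ 0)‖ ≤ ‖X₁ 0 - X₂ 0‖ + t * ‖V₁ 0 - V₂ 0‖ := by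
    refine (norm_add_le _ _).trans ?_
    rw [norm_smul, Real.norm_of_nonneg ht]
  rcases eq_or_lt_of_le (norm_nonneg D) with h0 | h0
  · rw [← h0]; positivity
  · refine le_trans (le_of_mul_le_mul_right ?_ h0) n1
    nlinarith

theorem inner_velocity_le (h₂ : IsProjectedCurve X₂ V₂)
    (h₁₂ : ∀ r s, 0 ≤ r → 0 ≤ s → inner ℝ (V₁ 0 - V₁ r) (X₂ s) ≤ 0)
    {r h : ℝ} (hr : 0 ≤ r) (hh : 0 < h) :
    inner ℝ (V₁ 0 - V₁ r) (V₂ r) ≤ - inner ℝ (V₁ 0 - V₁ r) (X₂ r) / h +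
      (‖V₁ 0 - V₂ 0‖ * ‖V₂ 0‖ + ‖V₁ r - V₂ r‖ ^ 2 / 4 + (‖V₂ r‖ ^ 2 - ‖V₂ (r + h)‖ ^ 2)) := by
  set B := ‖V₁ 0 - V₂ 0‖ * ‖V₂ 0‖ + ‖V₁ r - V₂ r‖ ^ 2 / 4 + (‖V₂ r‖ ^ 2 - ‖V₂ (r + h)‖ ^ 2)
    with hB
  have hbound : ∀ s, r ≤ s → s < r + h → inner ℝ (-(V₁ 0 - V₁ r)) (V₂ s) ≤
      B - inner ℝ (V₁ 0 - V₁ r) (V₂ r) := by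
    intro s hs hsh
    have e1 : inner ℝ (V₁ 0 - V₁ r) (V₂ r - V₂ s) = inner ℝ (V₁ 0 - V₂ 0) (V₂ r - V₂ s)
        - inner ℝ (V₁ r - V₂ r) (V₂ r - V₂ s) := by
      have a1 := h₂.inner_eq le_rfl hr
      have a2 := h₂.inner_eq le_rfl (hr.trans hs)
      have a3 := h₂.inner_eq hr hs
      have a4 := real_inner_self_eq_norm_sq (V₂ r)
      simp only [inner_sub_left, inner_sub_right]
      linarith
    have e2 := h₂.norm_sub_sq_eq hr hs
    have e3 := h₂.norm_sq_le (hr.trans hs) hsh.le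
    have e4 : ‖V₂ r - V₂ s‖ ≤ ‖V₂ 0‖ := by
      refine le_of_sq_le_sq ?_ (norm_nonneg _)
      have := h₂.norm_sq_le le_rfl hr
      nlinarith [sq_nonneg ‖V₂ s‖]
    have e5 := real_inner_le_norm (V₁ 0 - V₂ 0) (V₂ r - V₂ s)
    have e6 : ‖V₁ 0 - V₂ 0‖ * ‖V₂ r - V₂ s‖ ≤ ‖V₁ 0 - V₂ 0‖ * ‖V₂ 0‖ := by gcongr
    have e7 := neg_le_of_abs_le (abs_real_inner_le_norm (V₁ r - V₂ r) (V₂ r - V₂ s))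
    have e8 : inner ℝ (-(V₁ 0 - V₁ r)) (V₂ s) =
        inner ℝ (V₁ 0 - V₁ r) (V₂ r - V₂ s) - inner ℝ (V₁ 0 - V₁ r) (V₂ r) := by
      rw [inner_neg_left, inner_sub_right]; ring
    rw [e8, e1]
    nlinarith [sq_nonneg (‖V₁ r - V₂ r‖ / 2 - ‖V₂ r - V₂ s‖)]
  have key := h₂.inner_le_add_mul (-(V₁ 0 - V₁ r)) hr (le_add_of_nonneg_right hh.le) hbound
  rw [inner_neg_left, inner_neg_left, add_sub_cancel_left] at key
  have hp := h₁₂ r (r + h) hr (by linarith)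
  rw [← sub_le_iff_le_add, le_div_iff₀ hh]
  linarith

theorem norm_velocity_sub_sq_le (h₁ : IsProjectedCurve X₁ V₁) (h₂ : IsProjectedCurve X₂ V₂)
    (h₁₂ : ∀ r s, 0 ≤ r → 0 ≤ s → inner ℝ (V₁ 0 - V₁ r) (X₂ s) ≤ 0)
    (h₂₁ : ∀ r s, 0 ≤ r → 0 ≤ s → inner ℝ (V₂ 0 - V₂ r) (X₁ s) ≤ 0)
    {r h : ℝ} (hr : 0 ≤ r) (hh : 0 < h) :
    ‖V₁ r - V₂ r‖ ^ 2 ≤ 4 * (‖V₁ 0 - V₂ 0‖ * (‖V₁ 0‖ + ‖V₂ 0‖)) +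
      2 / h * (‖V₁ 0 - V₂ 0‖ * (‖X₁ 0 - X₂ 0‖ + r * ‖V₁ 0 - V₂ 0‖) -
        inner ℝ (X₁ r - X₂ r) (V₁ r - V₂ r)) +
      2 * ((‖V₁ r‖ ^ 2 - ‖V₁ (r + h)‖ ^ 2) + (‖V₂ r‖ ^ 2 - ‖V₂ (r + h)‖ ^ 2)) := by
  have b1 := h₂.inner_velocity_le h₁₂ hr hh
  have b2 := h₁.inner_velocity_le h₂₁ hr hh
  rw [norm_sub_rev (V₂ 0), norm_sub_rev (V₂ r)] at b2
  have o1 := h₁.inner_velocity 0 r le_rfl hr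
  have o2 := h₂.inner_velocity 0 r le_rfl hr
  have p1 := h₁.inner_position 0 r le_rfl hr
  have p2 := h₂.inner_position 0 r le_rfl hr
  have e1 : ‖V₁ r - V₂ r‖ ^ 2 = inner ℝ (V₁ 0 - V₂ 0) (V₁ r - V₂ r) +
      inner ℝ (V₁ 0 - V₁ r) (V₂ r) + inner ℝ (V₂ 0 - V₂ r) (V₁ r) := by
    rw [← real_inner_self_eq_norm_sq]
    simp only [inner_sub_left, inner_sub_right] at o1 o2 ⊢
    linarith
  have e2 : inner ℝ (V₁ 0 - V₂ 0) (V₁ r - V₂ r) ≤ ‖V₁ 0 - V₂ 0‖ * (‖V₁ 0‖ + ‖V₂ 0‖) := by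
    refine (real_inner_le_norm _ _).trans ?_
    gcongr
    exact (_root_.norm_sub_le _ _).trans (add_le_add (h₁.norm_le le_rfl hr) (h₂.norm_le le_rfl hr))
  have e3 : - inner ℝ (V₁ 0 - V₁ r) (X₂ r) - inner ℝ (V₂ 0 - V₂ r) (X₁ r) =
      inner ℝ (V₁ 0 - V₂ 0) (X₁ r - X₂ r) - inner ℝ (X₁ r - X₂ r) (V₁ r - V₂ r) := by
    rw [real_inner_comm (V₁ r - V₂ r)]
    simp only [inner_sub_left, inner_sub_right] at p1 p2 ⊢
    linarith
  have e4 : inner ℝ (V₁ 0 - V₂ 0) (X₁ r - X₂ r) ≤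
      ‖V₁ 0 - V₂ 0‖ * (‖X₁ 0 - X₂ 0‖ + r * ‖V₁ 0 - V₂ 0‖) := by
    refine (real_inner_le_norm _ _).trans ?_
    gcongr
    exact h₁.norm_sub_le h₂ h₁₂ h₂₁ hr
  have e5 : - inner ℝ (V₁ 0 - V₁ r) (X₂ r) / h + - inner ℝ (V₂ 0 - V₂ r) (X₁ r) / h ≤
      1 / h * (‖V₁ 0 - V₂ 0‖ * (‖X₁ 0 - X₂ 0‖ + r * ‖V₁ 0 - V₂ 0‖) -
        inner ℝ (X₁ r - X₂ r) (V₁ r - V₂ r)) := by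
    rw [← add_div, one_div_mul_eq_div]
    gcongr
    linarith
  have e6 : 2 / h * (‖V₁ 0 - V₂ 0‖ * (‖X₁ 0 - X₂ 0‖ + r * ‖V₁ 0 - V₂ 0‖) -
        inner ℝ (X₁ r - X₂ r) (V₁ r - V₂ r)) = 2 * (1 / h *
        (‖V₁ 0 - V₂ 0‖ * (‖X₁ 0 - X₂ 0‖ + r * ‖V₁ 0 - V₂ 0‖) -
        inner ℝ (X₁ r - X₂ r) (V₁ r - V₂ r))) := by ring
  rw [e6]
  linarith

theorem lintegral_velocity_le_add (h₁ : IsProjectedCurve X₁ V₁) (h₂ : IsProjectedCurve X₂ V₂)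
    (h₁₂ : ∀ r s, 0 ≤ r → 0 ≤ s → inner ℝ (V₁ 0 - V₁ r) (X₂ s) ≤ 0)
    (h₂₁ : ∀ r s, 0 ≤ r → 0 ≤ s → inner ℝ (V₂ 0 - V₂ r) (X₁ s) ≤ 0)
    {t h : ℝ} (ht : 0 ≤ t) (hh : 0 < h) :
    ∫⁻ r in Ioc 0 t, ENNReal.ofReal (‖V₁ r - V₂ r‖ ^ 2) ≤ ENNReal.ofReal
      (4 * (‖V₁ 0 - V₂ 0‖ * (‖V₁ 0‖ + ‖V₂ 0‖)) * t +
        (‖X₁ 0 - X₂ 0‖ + t * ‖V₁ 0 - V₂ 0‖) ^ 2 / h + 2 * h * (‖V₁ 0‖ ^ 2 + ‖V₂ 0‖ ^ 2)) := by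
  set U := ‖V₁ 0 - V₂ 0‖
  set W := ‖X₁ 0 - X₂ 0‖ with hW
  set A := U * (‖V₁ 0‖ + ‖V₂ 0‖)
  have hin : ∀ {X V : ℝ → H}, IsProjectedCurve X V → ∀ {r : ℝ}, 0 ≤ r →
      HasDerivWithinAt (fun s => inner ℝ (V 0) (X s) - inner ℝ (V 0) (X (s + h)))
        (‖V r‖ ^ 2 - ‖V (r + h)‖ ^ 2) (Ici r) r := by
    intro X V hX r hr
    have d1 := hX.hasDeriv_inner (V 0) hr
    have d2 := hX.hasDeriv_inner (V 0) (t := r + h) (by linarith)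
    have d3 := d2.comp r (h := fun s => s + h) ((hasDerivWithinAt_id r (Ici r)).add_const h)
      fun s hs => add_le_add_left (show r ≤ s from hs) h
    rw [hX.inner_eq le_rfl hr] at d1
    rw [hX.inner_eq le_rfl (by linarith : (0 : ℝ) ≤ r + h), mul_one] at d3
    exact d1.fun_sub d3
  have hcon : ∀ {X V : ℝ → H}, IsProjectedCurve X V →
      ContinuousOn (fun s => inner ℝ (V 0) (X s) - inner ℝ (V 0) (X (s + h))) (Icc 0 t) := by
    intro X V hX
    refine ((hX.continuousOn_inner (V 0)).mono Icc_subset_Ici_self).sub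
      ((hX.continuousOn_inner (V 0)).comp (by fun_prop) fun s hs => ?_)
    exact add_nonneg hs.1 hh.le
  have hup : ∀ {X V : ℝ → H}, IsProjectedCurve X V →
      inner ℝ (V 0) (X t) - inner ℝ (V 0) (X (t + h)) -
        (inner ℝ (V 0) (X 0) - inner ℝ (V 0) (X (0 + h))) ≤ h * ‖V 0‖ ^ 2 := by
    intro X V hX
    have u1 := hX.inner_le_add_mul (V 0) (c := ‖V 0‖ ^ 2) le_rfl
      (by linarith : (0 : ℝ) ≤ 0 + h) fun s hs _ => by
        rw [hX.inner_eq le_rfl hs]; exact hX.norm_sq_le le_rfl hs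
    have u2 := hX.inner_le_add_mul (-V 0) (c := 0) ht
      (by linarith : t ≤ t + h) fun s hs _ => by
        rw [inner_neg_left, hX.inner_eq le_rfl (ht.trans hs)]; simp
    simp only [inner_neg_left] at u2
    linarith
  have key := lintegral_le_of_hasDeriv_right
    (F := fun r => 4 * A * r + 2 / h * (U * W * r + U ^ 2 / 2 * r ^ 2 - ‖X₁ r - X₂ r‖ ^ 2 / 2) +
      2 * ((inner ℝ (V₁ 0) (X₁ r) - inner ℝ (V₁ 0) (X₁ (r + h))) +
        (inner ℝ (V₂ 0) (X₂ r) - inner ℝ (V₂ 0) (X₂ (r + h)))))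
    (F' := fun r => 4 * A + 2 / h * (U * (W + r * U) - inner ℝ (X₁ r - X₂ r) (V₁ r - V₂ r)) +
      2 * ((‖V₁ r‖ ^ 2 - ‖V₁ (r + h)‖ ^ 2) + (‖V₂ r‖ ^ 2 - ‖V₂ (r + h)‖ ^ 2)))
    (f := fun r => ‖V₁ r - V₂ r‖ ^ 2) ht ?_ ?_ ?_
  · refine key.trans (ENNReal.ofReal_le_ofReal ?_)
    have u1 := hup h₁
    have u2 := hup h₂
    have e : (W + t * U) ^ 2 / h = 2 / h * (U * W * t + U ^ 2 / 2 * t ^ 2) + W ^ 2 / h := by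
      field_simp; ring
    have e2 : 2 / h * (U * W * t + U ^ 2 / 2 * t ^ 2 - ‖X₁ t - X₂ t‖ ^ 2 / 2) ≤
        2 / h * (U * W * t + U ^ 2 / 2 * t ^ 2) := by
      gcongr
      have := sq_nonneg ‖X₁ t - X₂ t‖
      linarith
    have e3 : 2 / h * (U * W * 0 + U ^ 2 / 2 * 0 ^ 2 - ‖X₁ 0 - X₂ 0‖ ^ 2 / 2) = - (W ^ 2 / h) := by
      rw [← hW]; ring
    simp only [e3]
    linarith
  · have c1 := h₁.continuousOn.mono (Icc_subset_Ici_self : Icc 0 t ⊆ Ici 0)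
    have c2 := h₂.continuousOn.mono (Icc_subset_Ici_self : Icc 0 t ⊆ Ici 0)
    have c3 : ContinuousOn (fun r => 4 * A * r + 2 / h *
      (U * W * r + U ^ 2 / 2 * r ^ 2 - ‖X₁ r - X₂ r‖ ^ 2 / 2)) (Icc 0 t) := by fun_prop
    exact c3.add (((hcon h₁).add (hcon h₂)).const_mul 2)
  · intro r hr
    have d1 := ((h₁.hasDeriv r hr.1.le).sub (h₂.hasDeriv r hr.1.le)).norm_sq
    have d2 : HasDerivWithinAt (fun r => U * W * r + U ^ 2 / 2 * r ^ 2)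
        (U * (W + r * U)) (Ici r) r := by
      have := ((hasDerivAt_id r).const_mul (U * W)).fun_add
        (((hasDerivAt_id r).pow 2).const_mul (U ^ 2 / 2))
      refine (this.hasDerivWithinAt).congr_deriv ?_
      simp
      ring
    have d3 : HasDerivWithinAt (fun r => 4 * A * r) (4 * A) (Ici r) r := by
      simpa using (hasDerivWithinAt_id r (Ici r)).const_mul (4 * A)
    refine ((d3.fun_add ((d2.fun_sub (d1.div_const 2)).const_mul (2 / h))).fun_add
      (((hin h₁ hr.1.le).fun_add (hin h₂ hr.1.le)).const_mul 2)).congr_deriv ?_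
    simp
  · exact fun r hr => ⟨sq_nonneg _, h₁.norm_velocity_sub_sq_le h₂ h₁₂ h₂₁ hr.1.le hh⟩

theorem lintegral_velocity_le (h₁ : IsProjectedCurve X₁ V₁) (h₂ : IsProjectedCurve X₂ V₂)
    (h₁₂ : ∀ r s, 0 ≤ r → 0 ≤ s → inner ℝ (V₁ 0 - V₁ r) (X₂ s) ≤ 0)
    (h₂₁ : ∀ r s, 0 ≤ r → 0 ≤ s → inner ℝ (V₂ 0 - V₂ r) (X₁ s) ≤ 0)
    {t : ℝ} (ht : 0 ≤ t) :
    ∫⁻ r in Ioc 0 t, ENNReal.ofReal (‖V₁ r - V₂ r‖ ^ 2) ≤ ENNReal.ofReal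
      (7 * (1 + t) * (‖V₁ 0‖ + ‖V₂ 0‖) * (‖X₁ 0 - X₂ 0‖ + ‖V₁ 0 - V₂ 0‖)) := by
  set U := ‖V₁ 0 - V₂ 0‖
  set W := ‖X₁ 0 - X₂ 0‖
  have hU : 0 ≤ U := norm_nonneg _
  have hW : 0 ≤ W := norm_nonneg _
  set M := ‖V₁ 0‖ + ‖V₂ 0‖ with hM
  have hM0 : 0 ≤ M := by positivity
  have hM2 : ‖V₁ 0‖ ^ 2 + ‖V₂ 0‖ ^ 2 ≤ M ^ 2 := by
    rw [hM]; nlinarith [mul_nonneg (norm_nonneg (V₁ 0)) (norm_nonneg (V₂ 0))]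
  have key : ∀ e : ℝ, 0 < e → ∫⁻ r in Ioc 0 t, ENNReal.ofReal (‖V₁ r - V₂ r‖ ^ 2) ≤
      ENNReal.ofReal (4 * (U * M) * t + 3 * ((W + t * U + e) * (M + e))) := by
    intro e he
    have hpos : 0 < (W + t * U + e) / (M + e) := by positivity
    refine (h₁.lintegral_velocity_le_add h₂ h₁₂ h₂₁ ht hpos).trans (ENNReal.ofReal_le_ofReal ?_)
    have a1 : (W + t * U) ^ 2 / ((W + t * U + e) / (M + e)) ≤ (W + t * U + e) * (M + e) := by
      rw [div_le_iff₀ hpos]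
      have : (W + t * U + e) * (M + e) * ((W + t * U + e) / (M + e)) = (W + t * U + e) ^ 2 := by
        field_simp
      rw [this]
      exact pow_le_pow_left₀ (by positivity) (by linarith) 2
    have a2 : (W + t * U + e) / (M + e) * (‖V₁ 0‖ ^ 2 + ‖V₂ 0‖ ^ 2) ≤
        (W + t * U + e) * (M + e) := by
      calc _ ≤ (W + t * U + e) / (M + e) * (M + e) ^ 2 := by
            gcongr
            exact hM2.trans (by gcongr; linarith)
        _ = _ := by field_simp
    linarith
  have hlim : Tendsto (fun e : ℝ => ENNReal.ofReal
      (4 * (U * M) * t + 3 * ((W + t * U + e) * (M + e)))) (𝓝[>] 0)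
      (𝓝 (ENNReal.ofReal (4 * (U * M) * t + 3 * ((W + t * U + 0) * (M + 0))))) :=
    ((ENNReal.continuous_ofReal.comp (by fun_prop : Continuous fun e : ℝ =>
      4 * (U * M) * t + 3 * ((W + t * U + e) * (M + e)))).tendsto 0).mono_left nhdsWithin_le_nhds
  refine (ge_of_tendsto hlim (Filter.mem_of_superset self_mem_nhdsWithin key)).trans
    (ENNReal.ofReal_le_ofReal ?_)
  have i1 := mul_nonneg hM0 hW
  have i2 := mul_nonneg hM0 hU
  have i3 := mul_nonneg i1 ht
  have i4 := mul_nonneg i2 ht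
  nlinarith

end IsProjectedCurve

/-! ### Sticky motions as curves in a weighted Euclidean space -/

/-- The vector representing `f` in the Euclidean space weighted by the masses `m`. -/
noncomputable def weightedVec {N : ℕ} (m : Fin N → ℝ) : (Fin N → ℝ) →L[ℝ] EuclideanSpace ℝ (Fin N) :=
  ((EuclideanSpace.equiv (Fin N) ℝ).symm : (Fin N → ℝ) →L[ℝ] EuclideanSpace ℝ (Fin N)).comp
    (ContinuousLinearMap.pi fun i => √(m i) • ContinuousLinearMap.proj i)

variable {N : ℕ} {m : Fin N → ℝ} {x v x₁ v₁ x₂ v₂ : Fin N → ℝ → ℝ}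

theorem weightedVec_apply (m f : Fin N → ℝ) (i : Fin N) : weightedVec m f i = √(m i) * f i := by
  simp [weightedVec]

theorem inner_weightedVec (hm : ∀ i, 0 ≤ m i) (f g : Fin N → ℝ) :
    inner ℝ (weightedVec m f) (weightedVec m g) = ∑ i, m i * f i * g i := by
  rw [PiLp.inner_apply]
  refine Finset.sum_congr rfl fun i _ => ?_
  rw [weightedVec_apply, weightedVec_apply]
  simp only [RCLike.inner_apply, conj_trivial]
  calc _ = √(m i) * √(m i) * f i * g i := by ring
    _ = _ := by rw [Real.mul_self_sqrt (hm i)]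

theorem norm_weightedVec_sq (hm : ∀ i, 0 ≤ m i) (f : Fin N → ℝ) :
    ‖weightedVec m f‖ ^ 2 = ∑ i, m i * f i ^ 2 := by
  rw [← real_inner_self_eq_norm_sq, inner_weightedVec hm]
  exact Finset.sum_congr rfl fun i _ => by ring

theorem norm_weightedVec_sub_sq (hm : ∀ i, 0 ≤ m i) (f g : Fin N → ℝ) :
    ‖weightedVec m f - weightedVec m g‖ ^ 2 = ∑ i, m i * (f i - g i) ^ 2 := by
  rw [← map_sub, norm_weightedVec_sq hm]
  rfl

theorem inner_weightedVec_sub (hm : ∀ i, 0 ≤ m i) (f g h : Fin N → ℝ) :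
    inner ℝ (weightedVec m f - weightedVec m g) (weightedVec m h) =
      ∑ i, m i * f i * h i - ∑ i, m i * g i * h i := by
  rw [inner_sub_left, inner_weightedVec hm, inner_weightedVec hm]

namespace IsStickyMotion

theorem isProjectedCurve (h : IsStickyMotion m x v) :
    IsProjectedCurve (fun t => weightedVec m fun i => x i t)
      (fun t => weightedVec m fun i => v i t) where
  continuousOn := (weightedVec m).continuous.comp_continuousOn (continuousOn_pi.2 h.continuousOn)
  hasDeriv t ht := (weightedVec m).hasFDerivAt.comp_hasDerivWithinAt t
    (hasDerivWithinAt_pi.2 fun i => h.hasDeriv i t ht)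
  inner_velocity s t hs hst := by
    rw [inner_weightedVec_sub fun i => (h.mass_pos i).le, sub_eq_zero]
    exact h.momentum_eq hs hst fun i j hij => h.velocity_eq_of_eq (hs.trans hst) hij
  inner_position s t hs hst := by
    rw [inner_weightedVec_sub fun i => (h.mass_pos i).le, sub_eq_zero]
    exact h.momentum_eq hs hst fun i j hij => hij

theorem inner_velocity_sub_nonpos (h₁ : IsStickyMotion m x₁ v₁) (h₂ : IsStickyMotion m x₂ v₂)
    (r s : ℝ) (hr : 0 ≤ r) (hs : 0 ≤ s) :
    inner ℝ ((weightedVec m fun i => v₁ i 0) - weightedVec m fun i => v₁ i r)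
      (weightedVec m fun i => x₂ i s) ≤ 0 := by
  rw [inner_weightedVec_sub fun i => (h₁.mass_pos i).le, sub_nonpos]
  exact h₁.momentum_le le_rfl hr fun i j hij _ => h₂.ordered s hs hij

theorem lintegral_velocity_le (h₁ : IsStickyMotion m x₁ v₁) (h₂ : IsStickyMotion m x₂ v₂)
    {t : ℝ} (ht : 0 ≤ t) :
    ∫⁻ r in Ioc 0 t, ENNReal.ofReal (∑ i, m i * (v₁ i r - v₂ i r) ^ 2) ≤ ENNReal.ofReal
      (7 * (1 + t) * (√(∑ i, m i * v₁ i 0 ^ 2) + √(∑ i, m i * v₂ i 0 ^ 2)) *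
        (√(∑ i, m i * (x₁ i 0 - x₂ i 0) ^ 2) + √(∑ i, m i * (v₁ i 0 - v₂ i 0) ^ 2))) := by
  have hm : ∀ i, 0 ≤ m i := fun i => (h₁.mass_pos i).le
  have := h₁.isProjectedCurve.lintegral_velocity_le h₂.isProjectedCurve
    (h₁.inner_velocity_sub_nonpos h₂) (h₂.inner_velocity_sub_nonpos h₁) ht
  simpa only [← norm_weightedVec_sub_sq hm, ← norm_weightedVec_sq hm,
    Real.sqrt_sq (norm_nonneg _)] using this

end IsStickyMotion

/-! ### Finitely supported measures -/

/-- The measure `∑ mᵢ δ_{xᵢ}`. -/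
noncomputable def discreteMeasure {N : ℕ} {α : Type*} [MeasurableSpace α] (m : Fin N → ℝ) (x : Fin N → α) :
    Measure α :=
  ∑ i, ENNReal.ofReal (m i) • Measure.dirac (x i)

variable {N : ℕ} {m : Fin N → ℝ} {α β : Type*} [MeasurableSpace α] [MeasurableSpace β]

instance (m : Fin N → ℝ) (x : Fin N → α) : IsFiniteMeasure (discreteMeasure m x) := by
  refine ⟨?_⟩
  rw [discreteMeasure, Measure.finsetSum_apply]
  simp

theorem lintegral_discreteMeasure [MeasurableSingletonClass α] (m : Fin N → ℝ) (x : Fin N → α)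
    (f : α → ℝ≥0∞) :
    ∫⁻ z, f z ∂discreteMeasure m x = ∑ i, ENNReal.ofReal (m i) * f (x i) := by
  simp [discreteMeasure, lintegral_finsetSum_measure, lintegral_smul_measure]

theorem integrable_discreteMeasure [MeasurableSingletonClass α] (m : Fin N → ℝ) (x : Fin N → α)
    (f : α → ℝ) : Integrable f (discreteMeasure m x) := by
  rw [discreteMeasure, integrable_finsetSum_measure]
  exact fun i _ => (integrable_dirac (by simp)).smul_measure ENNReal.ofReal_ne_top

theorem integral_discreteMeasure [MeasurableSingletonClass α] (hm : ∀ i, 0 ≤ m i) (x : Fin N → α)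
    (f : α → ℝ) : ∫ z, f z ∂discreteMeasure m x = ∑ i, m i * f (x i) := by
  rw [discreteMeasure, integral_finsetSum_measure
    fun i _ => (integrable_dirac (by simp)).smul_measure ENNReal.ofReal_ne_top]
  refine Finset.sum_congr rfl fun i _ => ?_
  rw [integral_smul_measure, integral_dirac, ENNReal.toReal_ofReal (hm i), smul_eq_mul]

theorem map_discreteMeasure (m : Fin N → ℝ) (x : Fin N → α) {f : α → β} (hf : Measurable f) :
    (discreteMeasure m x).map f = discreteMeasure m fun i => f (x i) := by
  rw [discreteMeasure, Measure.map_finset_sum hf.aemeasurable]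
  simp [discreteMeasure, Measure.map_smul, Measure.map_dirac' hf]

theorem eq_of_ae_eq_discreteMeasure [MeasurableSingletonClass α] (hm : ∀ i, 0 < m i)
    {x : Fin N → α} {f g : α → ℝ} (h : f =ᵐ[discreteMeasure m x] g) (i : Fin N) :
    f (x i) = g (x i) := by
  have h0 : discreteMeasure m x {z | f z = g z}ᶜ = 0 := h
  by_contra hne
  rw [discreteMeasure, Measure.finsetSum_apply, Finset.sum_eq_zero_iff] at h0
  have h1 := h0 i (Finset.mem_univ i)
  simp only [Measure.smul_apply, smul_eq_mul, mul_eq_zero, ENNReal.ofReal_eq_zero, not_le.2 (hm i),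
    false_or, Measure.dirac_apply] at h1
  simp [Set.indicator, hne] at h1

theorem discreteState_density {N : ℕ} (m x v : Fin N → ℝ) :
    (discreteState m x v).density = discreteMeasure m x := rfl

theorem discreteState_velocity {N : ℕ} {m x v : Fin N → ℝ} (hm : ∀ i, 0 < m i)
    (hv : ∀ i j, x i = x j → v i = v j) (i : Fin N) :
    (discreteState m x v).velocity (x i) = v i := by
  set f : ℝ → ℝ := Function.extend x v 0 with hf
  have hfx : ∀ j, f (x j) = v j := fun j =>
    Function.FactorsThrough.extend_apply (fun a b hab => hv a b hab) 0 j
  have hint := integrable_discreteMeasure m x f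
  have hadd : (discreteState m x v).momentum = 0 + (discreteMeasure m x).withDensityᵥ f := by
    rw [zero_add]
    ext s hs
    rw [withDensityᵥ_apply hint hs, ← integral_indicator hs,
      integral_discreteMeasure fun i => (hm i).le]
    simp only [discreteState]
    rw [FunLike.coe_sum, Finset.sum_apply]
    refine Finset.sum_congr rfl fun j _ => ?_
    rw [_root_.smul_apply, Measure.toSignedMeasure_apply_measurable hs, Measure.real,
      Measure.dirac_apply' _ hs]
    by_cases hj : x j ∈ s <;> simp [hj, hfx]
  have := SignedMeasure.eq_rnDeriv (μ := discreteMeasure m x) 0 f hint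
    VectorMeasure.MutuallySingular.zero_left hadd
  rw [← hfx i]
  exact (eq_of_ae_eq_discreteMeasure hm this i).symm

/-! ### Monotone rearrangements of finitely supported measures -/

/-- The mass of the first `k` particles. -/
noncomputable def cumMass (m : Fin N → ℝ) (k : ℕ) : ℝ :=
  ∑ j with (j : Fin N).val < k, m j

theorem cumMass_zero (m : Fin N → ℝ) : cumMass m 0 = 0 := by simp [cumMass]

theorem cumMass_last (m : Fin N → ℝ) : cumMass m N = ∑ i, m i := by simp [cumMass]

theorem cumMass_succ (m : Fin N → ℝ) (k : Fin N) :
    cumMass m (k.val + 1) = cumMass m k.val + m k := by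
  have : (Finset.univ.filter fun j : Fin N => j.val < k.val + 1) =
      insert k (Finset.univ.filter fun j : Fin N => j.val < k.val) := by
    ext j
    simp only [Finset.mem_filter, Finset.mem_univ, true_and, Finset.mem_insert, Fin.ext_iff]
    omega
  rw [cumMass, this, Finset.sum_insert (by simp), add_comm, cumMass]

theorem cumMass_mono (hm : ∀ i, 0 ≤ m i) : Monotone (cumMass m) := fun k l hkl =>
  Finset.sum_le_sum_of_subset_of_nonneg
    (fun j hj => by
      simp only [Finset.mem_filter, Finset.mem_univ, true_and] at hj ⊢
      omega) fun i _ _ => hm i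

theorem discreteMeasure_real_Iic (hm : ∀ i, 0 ≤ m i) (x : Fin N → ℝ) (a : ℝ) :
    (discreteMeasure m x).real (Iic a) = ∑ i with x i ≤ a, m i := by
  rw [← integral_indicator_one measurableSet_Iic, integral_discreteMeasure hm, Finset.sum_filter]
  refine Finset.sum_congr rfl fun i _ => ?_
  by_cases h : x i ≤ a <;> simp [h]

theorem rearrangement_discreteMeasure (hm : ∀ i, 0 ≤ m i) {x : Fin N → ℝ} (hx : Monotone x)
    (k : Fin N) {w : ℝ} (hw : w ∈ Ico (cumMass m k.val) (cumMass m (k.val + 1))) :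
    rearrangement (discreteMeasure m x) w = x k := by
  have : {a : ℝ | w < (discreteMeasure m x).real (Iic a)} = Ici (x k) := by
    ext a
    simp only [Set.mem_ofPred_eq, Set.mem_Ici, discreteMeasure_real_Iic hm]
    refine ⟨fun h => ?_, fun h => hw.2.trans_le ?_⟩
    · by_contra! hlt
      refine absurd (h.trans_le ?_) (not_lt.2 hw.1)
      refine Finset.sum_le_sum_of_subset_of_nonneg (fun j hj => ?_) fun i _ _ => hm i
      simp only [Finset.mem_filter, Finset.mem_univ, true_and] at hj ⊢
      exact Fin.lt_def.1 (hx.reflect_lt (hj.trans_lt hlt))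
    · refine Finset.sum_le_sum_of_subset_of_nonneg (fun j hj => ?_) fun i _ _ => hm i
      simp only [Finset.mem_filter, Finset.mem_univ, true_and] at hj ⊢
      exact (hx (Fin.le_def.2 (Nat.lt_succ_iff.1 hj))).trans h
  rw [rearrangement, this, csInf_Ici]

/-- The image of Lebesgue measure under a step function. -/
theorem map_restrict_Ico_of_step {A : ℕ → ℝ} (hA : Monotone A) {f : ℝ → α} {p : ℕ → α} (n : ℕ)
    (hf : ∀ k < n, ∀ w ∈ Ico (A k) (A (k + 1)), f w = p k) :
    AEMeasurable f (volume.restrict (Ico (A 0) (A n))) ∧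
      (volume.restrict (Ico (A 0) (A n))).map f =
        ∑ k ∈ Finset.range n, ENNReal.ofReal (A (k + 1) - A k) • Measure.dirac (p k) := by
  induction n with
  | zero => simp
  | succ n ih =>
    obtain ⟨ih1, ih2⟩ := ih fun k hk => hf k (hk.trans n.lt_succ_self)
    have hae : f =ᵐ[volume.restrict (Ico (A n) (A (n + 1)))] fun _ => p n :=
      (ae_restrict_iff' measurableSet_Ico).2
        (Eventually.of_forall fun w hw => hf n n.lt_succ_self w hw)
    have hmeas : AEMeasurable f (volume.restrict (Ico (A n) (A (n + 1)))) :=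
      aemeasurable_const.congr hae.symm
    rw [← Ico_union_Ico_eq_Ico (hA (Nat.zero_le n)) (hA n.le_succ),
      Measure.restrict_union (Set.disjoint_left.2 fun w h1 h2 => absurd h1.2 (not_lt.2 h2.1))
        measurableSet_Ico]
    refine ⟨ih1.add_measure hmeas, ?_⟩
    rw [AEMeasurable.map_add₀ ih1 hmeas, ih2, Finset.sum_range_succ, Measure.map_congr hae,
      Measure.map_const]
    simp

theorem optimalCoupling_discreteMeasure (hm : ∀ i, 0 ≤ m i) (hsum : ∑ i, m i = 1)
    {x y : Fin N → ℝ} (hx : Monotone x) (hy : Monotone y) :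
    optimalCoupling (discreteMeasure m x) (discreteMeasure m y) =
      discreteMeasure m fun i => (x i, y i) := by
  have h := (map_restrict_Ico_of_step (cumMass_mono hm) (f := fun w =>
    (rearrangement (discreteMeasure m x) w, rearrangement (discreteMeasure m y) w))
    (p := fun k => if hk : k < N then (x ⟨k, hk⟩, y ⟨k, hk⟩) else 0) N fun k hk w hw => by
      simp only [hk, dif_pos]
      rw [rearrangement_discreteMeasure hm hx ⟨k, hk⟩ hw,
        rearrangement_discreteMeasure hm hy ⟨k, hk⟩ hw]).2
  rw [cumMass_zero, cumMass_last, hsum] at h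
  rw [optimalCoupling, Measure.restrict_congr_set Ioo_ae_eq_Ico, h, Finset.sum_range, discreteMeasure]
  refine Finset.sum_congr rfl fun i _ => ?_
  rw [cumMass_succ, add_sub_cancel_left]
  simp

theorem discreteMeasure_mem_couplings (m x y : Fin N → ℝ) :
    (discreteMeasure m fun i => (x i, y i)) ∈ couplings (discreteMeasure m x) (discreteMeasure m y) :=
  ⟨map_discreteMeasure m _ measurable_fst, map_discreteMeasure m _ measurable_snd⟩

theorem transportCost_discreteMeasure_le (ψ : ℝ → ℝ≥0∞) (m x y : Fin N → ℝ) :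
    transportCost ψ (discreteMeasure m x) (discreteMeasure m y) ≤
      ∑ i, ENNReal.ofReal (m i) * ψ (x i - y i) := by
  refine (iInf₂_le _ (discreteMeasure_mem_couplings m x y)).trans ?_
  rw [lintegral_discreteMeasure]

/-! ### Optimality of the monotone coupling -/

/-- The Monge condition for convex functions of the difference. -/
theorem _root_.ConvexOn.monge {g : ℝ → ℝ} (hg : ConvexOn ℝ univ g) {a a' b b' : ℝ} (ha : a ≤ a')
    (hb : b ≤ b') : g (a - b) + g (a' - b') ≤ g (a' - b) + g (a - b') := by
  rcases eq_or_lt_of_le (add_nonneg (sub_nonneg.2 ha) (sub_nonneg.2 hb)) with h | h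
  · have h1 : a' = a := by linarith
    have h2 : b' = b := by linarith
    rw [h1, h2]
  · set s := a' - a + (b' - b) with hs
    have c1 : 0 ≤ (a' - a) / s := div_nonneg (sub_nonneg.2 ha) h.le
    have c2 : 0 ≤ (b' - b) / s := div_nonneg (sub_nonneg.2 hb) h.le
    have c3 : (a' - a) / s + (b' - b) / s = 1 := by rw [← add_div, ← hs, div_self h.ne']
    have e1 := hg.2 (mem_univ (a - b')) (mem_univ (a' - b)) c1 c2 c3
    have e2 := hg.2 (mem_univ (a - b')) (mem_univ (a' - b)) c2 c1 (by rw [add_comm]; exact c3)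
    have f1 : ((a' - a) / s) • (a - b') + ((b' - b) / s) • (a' - b) = a - b := by
      simp only [smul_eq_mul]; field_simp; rw [hs]; ring
    have f2 : ((b' - b) / s) • (a - b') + ((a' - a) / s) • (a' - b) = a' - b' := by
      simp only [smul_eq_mul]; field_simp; rw [hs]; ring
    rw [f1] at e1
    rw [f2] at e2
    simp only [smul_eq_mul] at e1 e2
    calc _ ≤ ((a' - a) / s + (b' - b) / s) * (g (a' - b) + g (a - b')) := by linarith
      _ = _ := by rw [c3, one_mul]

/-- Kantorovich potentials for monotone sequences. -/
theorem exists_potentials {c : ℝ → ℝ → ℝ}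
    (hc : ∀ a a' b b', a ≤ a' → b ≤ b' → c a b + c a' b' ≤ c a' b + c a b')
    {x y : ℕ → ℝ} (hx : Monotone x) (hy : Monotone y) :
    ∃ φ χ : ℝ → ℝ, (∀ k, φ (x k) + χ (y k) = c (x k) (y k)) ∧
      ∀ k l, φ (x k) + χ (y l) ≤ c (x k) (y l) := by
  set u : ℕ → ℝ := fun k => ∑ j ∈ Finset.range k, (c (x (j + 1)) (y j) - c (x j) (y j)) with hu
  have hus : ∀ k, u (k + 1) = u k + (c (x (k + 1)) (y k) - c (x k) (y k)) := fun k =>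
    Finset.sum_range_succ _ k
  have up : ∀ l k, l ≤ k → u k - u l ≤ c (x k) (y l) - c (x l) (y l) := by
    intro l k hlk
    induction k, hlk using Nat.le_induction with
    | base => simp
    | succ k hlk ih =>
      have := hc _ _ _ _ (hx k.le_succ) (hy hlk)
      rw [hus]
      linarith
  have down : ∀ l k, l ≤ k → c (x k) (y k) - c (x l) (y k) ≤ u k - u l := by
    intro l k hlk
    induction k, hlk using Nat.le_induction with
    | base => simp
    | succ k hlk ih =>
      have := hc _ _ _ _ (hx (hlk.trans k.le_succ)) (hy k.le_succ)
      rw [hus]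
      linarith
  have main : ∀ k l, u k + (c (x l) (y l) - u l) ≤ c (x k) (y l) := by
    intro k l
    rcases le_total l k with h | h
    · linarith [up l k h]
    · linarith [down k l h]
  have fx : Function.FactorsThrough u x := by
    intro k l hkl
    refine le_antisymm ?_ ?_
    · have := main k l; rw [hkl] at this; linarith
    · have := main l k; rw [hkl] at this; linarith
  have fy : Function.FactorsThrough (fun l => c (x l) (y l) - u l) y := by
    intro k l hkl
    refine le_antisymm ?_ ?_
    · have := main l k; rw [hkl] at this; dsimp only; rw [hkl]; linarith
    · have := main k l; rw [← hkl] at this; dsimp only; rw [← hkl]; linarith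
  refine ⟨Function.extend x u 0, Function.extend y (fun l => c (x l) (y l) - u l) 0,
    fun k => ?_, fun k l => ?_⟩
  · rw [fx.extend_apply, fy.extend_apply]; ring
  · rw [fx.extend_apply, fy.extend_apply]; exact main k l

theorem exists_potentials_fin {c : ℝ → ℝ → ℝ}
    (hc : ∀ a a' b b', a ≤ a' → b ≤ b' → c a b + c a' b' ≤ c a' b + c a b')
    {x y : Fin N → ℝ} (hx : Monotone x) (hy : Monotone y) :
    ∃ φ χ : ℝ → ℝ, (∀ k, φ (x k) + χ (y k) = c (x k) (y k)) ∧
      ∀ k l, φ (x k) + χ (y l) ≤ c (x k) (y l) := by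
  rcases Nat.eq_zero_or_pos N with h0 | h0
  · subst h0
    exact ⟨0, 0, fun k => k.elim0, fun k => k.elim0⟩
  · set e : ℕ → Fin N := fun k => ⟨min k (N - 1), by omega⟩ with he
    have hem : Monotone e := fun k l hkl => by
      simp only [he, Fin.mk_le_mk]
      omega
    have hek : ∀ k : Fin N, e k.val = k := fun k => by
      ext
      simp only [he]
      omega
    obtain ⟨φ, χ, h1, h2⟩ := exists_potentials hc (hx.comp hem) (hy.comp hem)
    refine ⟨φ, χ, fun k => ?_, fun k l => ?_⟩
    · simpa [hek] using h1 k.val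
    · simpa [hek] using h2 k.val l.val

/-- The monotone coupling is optimal. -/
theorem sum_le_transportCost (hm : ∀ i, 0 ≤ m i) {g : ℝ → ℝ} (hg : ConvexOn ℝ univ g)
    (hg0 : ∀ a, 0 ≤ g a) {x y : Fin N → ℝ} (hx : Monotone x) (hy : Monotone y) :
    ∑ i, ENNReal.ofReal (m i) * ENNReal.ofReal (g (x i - y i)) ≤
      transportCost (fun a => ENNReal.ofReal (g a)) (discreteMeasure m x) (discreteMeasure m y) := by
  obtain ⟨φ, χ, h1, h2⟩ := exists_potentials_fin (c := fun a b => g (a - b))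
    (fun a a' b b' ha hb => hg.monge ha hb) hx hy
  refine le_iInf₂ fun γ hγ => ?_
  have iφ : Integrable (fun z : ℝ × ℝ => φ z.1) γ := by
    have := integrable_discreteMeasure m x φ
    rw [← hγ.1] at this
    exact this.comp_measurable measurable_fst
  have iχ : Integrable (fun z : ℝ × ℝ => χ z.2) γ := by
    have := integrable_discreteMeasure m y χ
    rw [← hγ.2] at this
    exact this.comp_measurable measurable_snd
  have eφ : ∫ z, φ z.1 ∂γ = ∑ i, m i * φ (x i) := by
    rw [← integral_discreteMeasure hm, ← hγ.1, integral_map measurable_fst.aemeasurable]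
    rw [hγ.1]
    exact (integrable_discreteMeasure m x φ).aestronglyMeasurable
  have eχ : ∫ z, χ z.2 ∂γ = ∑ i, m i * χ (y i) := by
    rw [← integral_discreteMeasure hm, ← hγ.2, integral_map measurable_snd.aemeasurable]
    rw [hγ.2]
    exact (integrable_discreteMeasure m y χ).aestronglyMeasurable
  have hsupp : ∀ x : Fin N → ℝ, ∀ᵐ a ∂discreteMeasure m x, a ∈ Set.range x := fun x => by
    have hms : MeasurableSet (Set.range x)ᶜ := (Set.finite_range x).measurableSet.compl
    rw [ae_iff]
    change discreteMeasure m x (Set.range x)ᶜ = 0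
    rw [← lintegral_indicator_one hms, lintegral_discreteMeasure]
    simp
  have ax : ∀ᵐ z ∂γ, z.1 ∈ Set.range x := by
    have := hsupp x
    rw [← hγ.1] at this
    exact ae_of_ae_map measurable_fst.aemeasurable this
  have ay : ∀ᵐ z ∂γ, z.2 ∈ Set.range y := by
    have := hsupp y
    rw [← hγ.2] at this
    exact ae_of_ae_map measurable_snd.aemeasurable this
  calc ∑ i, ENNReal.ofReal (m i) * ENNReal.ofReal (g (x i - y i))
      = ENNReal.ofReal (∑ i, m i * g (x i - y i)) := by
        rw [ENNReal.ofReal_sum_of_nonneg fun i _ => mul_nonneg (hm i) (hg0 _)]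
        exact Finset.sum_congr rfl fun i _ => (ENNReal.ofReal_mul (hm i)).symm
    _ = ENNReal.ofReal (∫ z, (φ z.1 + χ z.2) ∂γ) := by
        rw [integral_add iφ iχ, eφ, eχ, ← Finset.sum_add_distrib]
        congr 1
        exact Finset.sum_congr rfl fun i _ => by rw [← h1 i]; ring
    _ ≤ ∫⁻ z, ENNReal.ofReal (φ z.1 + χ z.2) ∂γ := by
        rw [integral_eq_lintegral_pos_part_sub_lintegral_neg_part (iφ.fun_add iχ)]
        exact (ENNReal.ofReal_le_ofReal (sub_le_self _ ENNReal.toReal_nonneg)).trans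
          ENNReal.ofReal_toReal_le
    _ ≤ ∫⁻ z, ENNReal.ofReal (g (z.1 - z.2)) ∂γ := by
        refine lintegral_mono_ae ?_
        filter_upwards [ax, ay] with z hz1 hz2
        obtain ⟨k, hk⟩ := hz1
        obtain ⟨l, hl⟩ := hz2
        rw [← hk, ← hl]
        exact ENNReal.ofReal_le_ofReal (h2 k l)

/-! ### Common refinement of two mass partitions -/

/-- The length of the intersection of `[a, a']` and `[b, b']`. -/
noncomputable def overlap (a a' b b' : ℝ) : ℝ := max a (min b' a') - max a (min b a')

theorem overlap_comm {a a' b b' : ℝ} (ha : a ≤ a') (hb : b ≤ b') :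
    overlap a a' b b' = overlap b b' a a' := by
  unfold overlap
  rcases le_total a b with h1 | h1 <;> rcases le_total a b' with h2 | h2 <;>
    rcases le_total a' b with h3 | h3 <;> rcases le_total a' b' with h4 | h4 <;>
    simp only [h1, h2, h3, h4, ha, hb, min_eq_left, min_eq_right, max_eq_left, max_eq_right] <;>
    linarith

theorem overlap_nonneg {b b' : ℝ} (a a' : ℝ) (hb : b ≤ b') : 0 ≤ overlap a a' b b' :=
  sub_nonneg.2 (max_le_max_left _ (min_le_min_right _ hb))

theorem lt_of_overlap_pos {a a' b b' : ℝ} (h : 0 < overlap a a' b b') : a < b' := by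
  by_contra! hba
  rw [overlap, max_eq_left ((min_le_left _ _).trans hba)] at h
  linarith [le_max_left a (min b a')]

theorem sum_overlap_cumMass {N : ℕ} {m : Fin N → ℝ} (hsum : ∑ i, m i = 1)
    {a a' : ℝ} (h0 : 0 ≤ a) (ha : a ≤ a') (h1 : a' ≤ 1) :
    ∑ j : Fin N, overlap a a' (cumMass m j.val) (cumMass m (j.val + 1)) = a' - a := by
  rw [← Finset.sum_range fun j => overlap a a' (cumMass m j) (cumMass m (j + 1))]
  simp only [overlap]
  rw [Finset.sum_range_sub (fun j => max a (min (cumMass m j) a')), cumMass_last, hsum,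
    cumMass_zero, min_eq_right h1, max_eq_right ha, min_eq_left (h0.trans ha), max_eq_left h0]

theorem cumMass_le_one {N : ℕ} {m : Fin N → ℝ} (hm : ∀ i, 0 ≤ m i) (hsum : ∑ i, m i = 1) (k : ℕ) :
    cumMass m k ≤ 1 := by
  rw [← hsum]
  exact Finset.sum_le_sum_of_subset_of_nonneg (Finset.filter_subset _ _) fun i _ _ => hm i

theorem cumMass_nonneg {N : ℕ} {m : Fin N → ℝ} (hm : ∀ i, 0 ≤ m i) (k : ℕ) : 0 ≤ cumMass m k :=
  Finset.sum_nonneg fun i _ => hm i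

/-- The masses `m`, indexed by a refinement `i` of the particles with masses `m₁`. -/
structure IsMassRefinement {n N : ℕ} (m : Fin n → ℝ) (m₁ : Fin N → ℝ) (i : Fin n → Fin N) : Prop where
  mass_pos : ∀ k, 0 < m k
  mono : Monotone i
  sum_fiber : ∀ j, ∑ k with i k = j, m k = m₁ j

theorem exists_common_refinement {N₁ N₂ : ℕ} {m₁ : Fin N₁ → ℝ} {m₂ : Fin N₂ → ℝ}
    (hm₁ : ∀ i, 0 < m₁ i) (hm₂ : ∀ i, 0 < m₂ i) (hs₁ : ∑ i, m₁ i = 1) (hs₂ : ∑ i, m₂ i = 1) :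
    ∃ (n : ℕ) (m : Fin n → ℝ) (i₁ : Fin n → Fin N₁) (i₂ : Fin n → Fin N₂),
      IsMassRefinement m m₁ i₁ ∧ IsMassRefinement m m₂ i₂ := by
  classical
  have mono₁ := cumMass_mono fun i => (hm₁ i).le
  have mono₂ := cumMass_mono fun i => (hm₂ i).le
  set q : Fin N₁ → Fin N₂ → ℝ := fun i j => overlap (cumMass m₁ i.val) (cumMass m₁ (i.val + 1))
    (cumMass m₂ j.val) (cumMass m₂ (j.val + 1)) with hq
  have hq' : ∀ i j, q i j = overlap (cumMass m₂ j.val) (cumMass m₂ (j.val + 1))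
      (cumMass m₁ i.val) (cumMass m₁ (i.val + 1)) := fun i j =>
    overlap_comm (mono₁ (Nat.le_succ _)) (mono₂ (Nat.le_succ _))
  have hq0 : ∀ i j, 0 ≤ q i j := fun i j => overlap_nonneg _ _ (mono₂ (Nat.le_succ _))
  have sum₂ : ∀ i, ∑ j, q i j = m₁ i := fun i => by
    rw [hq, sum_overlap_cumMass hs₂ (cumMass_nonneg (fun i => (hm₁ i).le) _)
      (mono₁ (Nat.le_succ _)) (cumMass_le_one (fun i => (hm₁ i).le) hs₁ _), cumMass_succ]
    ring
  have sum₁ : ∀ j, ∑ i, q i j = m₂ j := fun j => by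
    rw [Finset.sum_congr rfl fun i _ => hq' i j,
      sum_overlap_cumMass hs₁ (cumMass_nonneg (fun i => (hm₂ i).le) _)
      (mono₂ (Nat.le_succ _)) (cumMass_le_one (fun i => (hm₂ i).le) hs₂ _), cumMass_succ]
    ring
  let ι := {p : Fin N₁ ×ₗ Fin N₂ // 0 < q (ofLex p).1 (ofLex p).2}
  let e : Fin (Fintype.card ι) ≃o ι := (Fintype.orderIsoFinOfCardEq ι rfl)
  have hmono₁ : Monotone fun p : ι => (ofLex p.1).1 := fun p p' hp =>
    Prod.Lex.monotone_fst _ _ hp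
  have hmono₂ : Monotone fun p : ι => (ofLex p.1).2 := fun p p' hp => by
    rcases (Prod.Lex.le_iff.1 (show p.1 ≤ p'.1 from hp)) with h | h
    · by_contra! hlt
      have a1 : cumMass m₂ (ofLex p.1).2.val < cumMass m₁ ((ofLex p.1).1.val + 1) := by
        refine lt_of_overlap_pos (a' := cumMass m₂ ((ofLex p.1).2.val + 1))
          (b := cumMass m₁ (ofLex p.1).1.val) ?_
        rw [← hq']
        exact p.2
      have a2 : cumMass m₁ (ofLex p'.1).1.val < cumMass m₂ ((ofLex p'.1).2.val + 1) :=
        lt_of_overlap_pos p'.2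
      have a3 := mono₁ (Nat.succ_le_of_lt (Fin.lt_def.1 h))
      have a4 := mono₂ (Nat.succ_le_of_lt (Fin.lt_def.1 hlt))
      simp only [Nat.succ_eq_add_one] at a3 a4
      linarith
    · exact h.2
  have hsum : ∀ (P : Fin N₁ → Fin N₂ → Prop) [∀ i j, Decidable (P i j)], ∑ k with P (ofLex (e k).1).1 (ofLex (e k).1).2,
      q (ofLex (e k).1).1 (ofLex (e k).1).2 = ∑ i, ∑ j, if P i j then q i j else 0 := by
    intro P _
    rw [Finset.sum_filter]
    refine (Equiv.sum_comp e.toEquiv fun p : ι =>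
      if P (ofLex p.1).1 (ofLex p.1).2 then q (ofLex p.1).1 (ofLex p.1).2 else 0).trans ?_
    rw [← Finset.sum_subtype (Finset.univ.filter fun p : Fin N₁ ×ₗ Fin N₂ =>
      0 < q (ofLex p).1 (ofLex p).2) (by simp) fun p : Fin N₁ ×ₗ Fin N₂ =>
      if P (ofLex p).1 (ofLex p).2 then q (ofLex p).1 (ofLex p).2 else 0]
    rw [Finset.sum_filter_of_ne fun p _ hp => lt_of_le_of_ne (hq0 _ _) fun h0 => hp (by
      rw [← h0, ite_self])]
    rw [← Equiv.sum_comp toLex fun p : Fin N₁ ×ₗ Fin N₂ =>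
      if P (ofLex p).1 (ofLex p).2 then q (ofLex p).1 (ofLex p).2 else 0]
    exact Fintype.sum_prod_type _
  refine ⟨Fintype.card ι, fun k => q (ofLex (e k).1).1 (ofLex (e k).1).2,
    fun k => (ofLex (e k).1).1, fun k => (ofLex (e k).1).2,
    ⟨fun k => (e k).2, hmono₁.comp e.monotone, fun i => ?_⟩,
    ⟨fun k => (e k).2, hmono₂.comp e.monotone, fun j => ?_⟩⟩
  · rw [hsum fun i' _ => i' = i, Finset.sum_eq_single i (fun i' _ h => by simp [h]) (by simp)]
    simpa using sum₂ i
  · rw [hsum fun _ j' => j' = j, Finset.sum_congr rfl fun i _ =>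
      Finset.sum_eq_single j (fun j' _ h => by simp [h]) (by simp)]
    simpa using sum₁ j

namespace IsMassRefinement

variable {n N : ℕ} {m : Fin n → ℝ} {m₁ : Fin N → ℝ} {i : Fin n → Fin N}

theorem surjective (h : IsMassRefinement m m₁ i) (hm₁ : ∀ j, 0 < m₁ j) : Function.Surjective i := by
  intro j
  by_contra! hne
  have := h.sum_fiber j
  rw [Finset.sum_eq_zero fun k hk => absurd (Finset.mem_filter.1 hk).2 (hne k)] at this
  exact (hm₁ j).ne this

theorem sum_comp_mul (h : IsMassRefinement m m₁ i) (f : Fin N → ℝ) :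
    ∑ k, m k * f (i k) = ∑ j, m₁ j * f j := by
  rw [← Finset.sum_fiberwise Finset.univ i]
  refine Finset.sum_congr rfl fun j _ => ?_
  rw [← h.sum_fiber, Finset.sum_mul]
  exact Finset.sum_congr rfl fun k hk => by rw [(Finset.mem_filter.1 hk).2]

theorem sum_cluster_comp_mul (h : IsMassRefinement m m₁ i) (x : Fin N → ℝ → ℝ) (k : Fin n) (t : ℝ)
    (f : Fin N → ℝ) :
    ∑ l ∈ cluster (fun k => x (i k)) k t, m l * f (i l) = ∑ j ∈ cluster x (i k) t, m₁ j * f j := by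
  classical
  have := h.sum_comp_mul fun j => if x j t = x (i k) t then f j else 0
  simp only [mul_ite, mul_zero, ← Finset.sum_filter] at this
  convert this using 2 <;> simp only [cluster]

theorem collisionTimes_comp (h : IsMassRefinement m m₁ i) (hm₁ : ∀ j, 0 < m₁ j)
    (x : Fin N → ℝ → ℝ) : collisionTimes (fun k => x (i k)) = collisionTimes x := by
  ext t
  simp only [collisionTimes, Set.mem_ofPred_eq, (h.surjective hm₁).exists]

theorem isStickyMotion (h : IsMassRefinement m m₁ i) {x v : Fin N → ℝ → ℝ}
    (hx : IsStickyMotion m₁ x v) : IsStickyMotion m (fun k => x (i k)) (fun k => v (i k)) where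
  mass_pos := h.mass_pos
  mass_sum := by
    have := h.sum_comp_mul fun _ => 1
    simpa [hx.mass_sum] using this
  ordered t ht := (hx.ordered t ht).comp h.mono
  sticky k s t hs hst l hl :=
    mem_cluster.2 (hx.eq_of_eq hs hst ((mem_cluster (x := fun k => x (i k))).1 hl))
  continuousOn k := hx.continuousOn (i k)
  hasDeriv k := hx.hasDeriv (i k)
  free k s t hs hst hdis := by
    rw [h.collisionTimes_comp hx.mass_pos] at hdis
    exact hx.free (i k) s t hs hst hdis
  collision t ht := by
    rw [h.collisionTimes_comp hx.mass_pos] at ht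
    obtain ⟨w, hw, hv⟩ := hx.collision t ht
    refine ⟨fun k => w (i k), fun k => hw (i k), fun k => ?_⟩
    have e1 := h.sum_cluster_comp_mul x k t fun _ => 1
    simp only [mul_one] at e1
    rw [hv (i k), h.sum_cluster_comp_mul x k t w, e1]

theorem discreteState_comp (h : IsMassRefinement m m₁ i) (x v : Fin N → ℝ) :
    discreteState m (fun k => x (i k)) (fun k => v (i k)) = discreteState m₁ x v := by
  unfold discreteState
  congr 1
  · rw [← Finset.sum_fiberwise Finset.univ i]
    refine Finset.sum_congr rfl fun j _ => ?_
    rw [← h.sum_fiber, ENNReal.ofReal_sum_of_nonneg fun k _ => (h.mass_pos k).le, Finset.sum_smul]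
    exact Finset.sum_congr rfl fun k hk => by simp only [(Finset.mem_filter.1 hk).2]
  · rw [← Finset.sum_fiberwise Finset.univ i]
    refine Finset.sum_congr rfl fun j _ => ?_
    rw [← h.sum_fiber, Finset.sum_mul, Finset.sum_smul]
    exact Finset.sum_congr rfl fun k hk => by simp only [(Finset.mem_filter.1 hk).2]

end IsMassRefinement

/-- Two sticky particle solutions can be represented by particles with the same masses. -/
theorem exists_common_masses {μ₁ μ₂ : ℝ → PhaseState} (h₁ : IsStickySolution μ₁)
    (h₂ : IsStickySolution μ₂) :
    ∃ (N : ℕ) (m : Fin N → ℝ) (x₁ v₁ x₂ v₂ : Fin N → ℝ → ℝ),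
      IsStickyMotion m x₁ v₁ ∧ IsStickyMotion m x₂ v₂ ∧
      (∀ t, 0 ≤ t → μ₁ t = discreteState m (fun i => x₁ i t) (fun i => v₁ i t)) ∧
      ∀ t, 0 ≤ t → μ₂ t = discreteState m (fun i => x₂ i t) (fun i => v₂ i t) := by
  obtain ⟨N₁, m₁, x₁, v₁, hx₁, e₁⟩ := h₁
  obtain ⟨N₂, m₂, x₂, v₂, hx₂, e₂⟩ := h₂
  obtain ⟨n, m, i₁, i₂, r₁, r₂⟩ := exists_common_refinement hx₁.mass_pos hx₂.mass_pos
    hx₁.mass_sum hx₂.mass_sum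
  refine ⟨n, m, fun k => x₁ (i₁ k), fun k => v₁ (i₁ k), fun k => x₂ (i₂ k), fun k => v₂ (i₂ k),
    r₁.isStickyMotion hx₁, r₂.isStickyMotion hx₂, fun t ht => ?_, fun t ht => ?_⟩
  · rw [e₁ t ht]; exact (r₁.discreteState_comp (fun j => x₁ j t) (fun j => v₁ j t)).symm
  · rw [e₂ t ht]; exact (r₂.discreteState_comp (fun j => x₂ j t) (fun j => v₂ j t)).symm

/-! ### Stability of sticky particle solutions -/

theorem convexOn_abs_rpow {p : ℝ} (hp : 1 ≤ p) : ConvexOn ℝ univ fun a : ℝ => |a| ^ p := by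
  refine ⟨convex_univ, fun x _ y _ a b ha hb hab => ?_⟩
  have h := (convexOn_rpow hp).2 (mem_Ici.2 (abs_nonneg x)) (mem_Ici.2 (abs_nonneg y)) ha hb hab
  refine le_trans (Real.rpow_le_rpow (abs_nonneg _) ?_ (by linarith)) h
  calc |a • x + b • y| ≤ |a • x| + |b • y| := abs_add_le _ _
    _ = a • |x| + b • |y| := by
      simp only [smul_eq_mul, abs_mul, abs_of_nonneg ha, abs_of_nonneg hb]

theorem isConvexCost_abs_rpow {p : ℝ} (hp : 1 ≤ p) :
    IsConvexCost fun a => ENNReal.ofReal (|a| ^ p) where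
  convex x y a b ha hb hab := by
    rw [← ENNReal.ofReal_mul ha, ← ENNReal.ofReal_mul hb, ← ENNReal.ofReal_add (by positivity)
      (by positivity)]
    exact ENNReal.ofReal_le_ofReal ((convexOn_abs_rpow hp).2 (mem_univ x) (mem_univ y) ha hb hab)
  even x := by rw [abs_neg]
  lsc := (ENNReal.continuous_ofReal.comp
    ((continuous_abs).rpow_const fun _ => Or.inr (by linarith))).lowerSemicontinuous

theorem PhaseState.measurable_velocity (μ : PhaseState) : Measurable μ.velocity :=
  SignedMeasure.measurable_rnDeriv _ _

/-- The semidistance between the free evolutions is controlled by Minkowski's inequality. -/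
theorem lintegral_free_le {p : ℝ} (hp : 1 ≤ p) (μ₁ μ₂ : PhaseState) {t : ℝ} (ht : 0 ≤ t)
    (Γ : Measure (ℝ × ℝ)) :
    (∫⁻ z, ENNReal.ofReal (|(z.1 + t * μ₁.velocity z.1) - (z.2 + t * μ₂.velocity z.2)| ^ p) ∂Γ)
        ^ (1 / p) ≤
      (∫⁻ z, ENNReal.ofReal (|z.1 - z.2| ^ p) ∂Γ) ^ (1 / p) + ENNReal.ofReal t *
        (∫⁻ z, ENNReal.ofReal (|μ₁.velocity z.1 - μ₂.velocity z.2| ^ p) ∂Γ) ^ (1 / p) := by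
  have hp0 : 0 < p := by linarith
  have m1 := μ₁.measurable_velocity
  have m2 := μ₂.measurable_velocity
  set f : ℝ × ℝ → ℝ≥0∞ := fun z => ENNReal.ofReal |z.1 - z.2|
  set g : ℝ × ℝ → ℝ≥0∞ := fun z =>
    ENNReal.ofReal t * ENNReal.ofReal |μ₁.velocity z.1 - μ₂.velocity z.2| with hg
  have hfm : Measurable f := by fun_prop
  have hgm : Measurable g := by fun_prop
  have e1 : ∀ a : ℝ, ENNReal.ofReal (|a| ^ p) = ENNReal.ofReal |a| ^ p := fun a =>
    (ENNReal.ofReal_rpow_of_nonneg (abs_nonneg a) hp0.le).symm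
  have e2 : ENNReal.ofReal t *
        (∫⁻ z, ENNReal.ofReal (|μ₁.velocity z.1 - μ₂.velocity z.2| ^ p) ∂Γ) ^ (1 / p) =
      (∫⁻ z, g z ^ p ∂Γ) ^ (1 / p) := by
    simp only [hg, e1, ENNReal.mul_rpow_of_nonneg _ _ hp0.le]
    rw [lintegral_const_mul' _ _ (ENNReal.rpow_ne_top_of_nonneg hp0.le ENNReal.ofReal_ne_top),
      ENNReal.mul_rpow_of_nonneg _ _ (by positivity), ← ENNReal.rpow_mul, mul_one_div_cancel hp0.ne',
      ENNReal.rpow_one]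
  rw [e2]
  simp only [e1]
  refine le_trans ?_ (ENNReal.lintegral_Lp_add_le hfm.aemeasurable hgm.aemeasurable hp)
  gcongr with z
  simp only [Pi.add_apply, hg]
  rw [← ENNReal.ofReal_mul ht, ← ENNReal.ofReal_add (abs_nonneg _) (by positivity)]
  refine ENNReal.ofReal_le_ofReal ?_
  rw [show z.1 + t * μ₁.velocity z.1 - (z.2 + t * μ₂.velocity z.2) =
    (z.1 - z.2) + t * (μ₁.velocity z.1 - μ₂.velocity z.2) by ring]
  refine (abs_add_le _ _).trans ?_
  rw [abs_mul, abs_of_nonneg ht]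

theorem sum_ofReal_rpow_two {N : ℕ} {m : Fin N → ℝ} (hm : ∀ i, 0 ≤ m i) (a : Fin N → ℝ) :
    (∑ i, ENNReal.ofReal (m i) * ENNReal.ofReal (|a i| ^ (2 : ℝ))) ^ (1 / (2 : ℝ)) =
      ENNReal.ofReal √(∑ i, m i * a i ^ 2) := by
  have h : ∑ i, ENNReal.ofReal (m i) * ENNReal.ofReal (|a i| ^ (2 : ℝ)) =
      ENNReal.ofReal (∑ i, m i * a i ^ 2) := by
    rw [ENNReal.ofReal_sum_of_nonneg fun i _ => mul_nonneg (hm i) (sq_nonneg _)]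
    refine Finset.sum_congr rfl fun i _ => ?_
    rw [← ENNReal.ofReal_mul (hm i), Real.rpow_two, sq_abs]
  rw [h, ENNReal.ofReal_rpow_of_nonneg
    (Finset.sum_nonneg fun i _ => mul_nonneg (hm i) (sq_nonneg _)) (by norm_num),
    Real.sqrt_eq_rpow]

variable {N : ℕ} {m : Fin N → ℝ} {x₁ v₁ x₂ v₂ x v : Fin N → ℝ → ℝ}

/-- The state at time `t` of a particle motion. -/
noncomputable def motionState (m : Fin N → ℝ) (x v : Fin N → ℝ → ℝ) (t : ℝ) : PhaseState :=
  discreteState m (fun i => x i t) (fun i => v i t)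

namespace IsStickyMotion

theorem velocity_motionState (h : IsStickyMotion m x v) {t : ℝ} (ht : 0 ≤ t) (i : Fin N) :
    (motionState m x v t).velocity (x i t) = v i t :=
  discreteState_velocity (x := fun i => x i t) (v := fun i => v i t) h.mass_pos
    (fun _ _ hij => h.velocity_eq_of_eq ht hij) i

theorem optimalCoupling_motionState (h₁ : IsStickyMotion m x₁ v₁) (h₂ : IsStickyMotion m x₂ v₂)
    {t : ℝ} (ht : 0 ≤ t) :
    optimalCoupling (motionState m x₁ v₁ t).density (motionState m x₂ v₂ t).density =
      discreteMeasure m fun i => (x₁ i t, x₂ i t) :=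
  optimalCoupling_discreteMeasure (fun i => (h₁.mass_pos i).le) h₁.mass_sum (h₁.ordered t ht)
    (h₂.ordered t ht)

theorem transportCost_le (h₁ : IsStickyMotion m x₁ v₁) (h₂ : IsStickyMotion m x₂ v₂)
    {t : ℝ} (ht : 0 ≤ t) {ψ : ℝ → ℝ≥0∞} (hψ : IsConvexCost ψ) :
    transportCost ψ (motionState m x₁ v₁ t).density (motionState m x₂ v₂ t).density ≤
      ∫⁻ z, ψ ((z.1 + t * (motionState m x₁ v₁ 0).velocity z.1) -
          (z.2 + t * (motionState m x₂ v₂ 0).velocity z.2))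
        ∂(optimalCoupling (motionState m x₁ v₁ 0).density (motionState m x₂ v₂ 0).density) := by
  rw [h₁.optimalCoupling_motionState h₂ le_rfl, lintegral_discreteMeasure]
  simp only [h₁.velocity_motionState le_rfl, h₂.velocity_motionState le_rfl]
  exact (transportCost_discreteMeasure_le ψ m _ _).trans (h₁.sum_cost_le h₂ ht hψ)

theorem lintegral_optimalCoupling_le_transportCost (h₁ : IsStickyMotion m x₁ v₁)
    (h₂ : IsStickyMotion m x₂ v₂) {t : ℝ} (ht : 0 ≤ t) {p : ℝ} (hp : 1 ≤ p) :
    ∫⁻ z, ENNReal.ofReal (|z.1 - z.2| ^ p)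
        ∂(optimalCoupling (motionState m x₁ v₁ t).density (motionState m x₂ v₂ t).density) ≤
      transportCost (fun a => ENNReal.ofReal (|a| ^ p))
        (motionState m x₁ v₁ t).density (motionState m x₂ v₂ t).density := by
  rw [h₁.optimalCoupling_motionState h₂ ht, lintegral_discreteMeasure]
  exact sum_le_transportCost (fun i => (h₁.mass_pos i).le) (convexOn_abs_rpow hp)
    (fun a => by positivity) (h₁.ordered t ht) (h₂.ordered t ht)

theorem wasserstein_le (h₁ : IsStickyMotion m x₁ v₁) (h₂ : IsStickyMotion m x₂ v₂)
    {t : ℝ} (ht : 0 ≤ t) {p : ℝ} (hp : 1 ≤ p) :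
    wasserstein p (motionState m x₁ v₁ t).density (motionState m x₂ v₂ t).density ≤
      wasserstein p (motionState m x₁ v₁ 0).density (motionState m x₂ v₂ 0).density +
        ENNReal.ofReal t * velocityDist p (motionState m x₁ v₁ 0) (motionState m x₂ v₂ 0) := by
  have hp0 : 0 ≤ 1 / p := by positivity
  refine (ENNReal.rpow_le_rpow (h₁.transportCost_le h₂ ht (isConvexCost_abs_rpow hp)) hp0).trans ?_
  refine (lintegral_free_le hp _ _ ht _).trans (add_le_add ?_ le_rfl)
  exact ENNReal.rpow_le_rpow (h₁.lintegral_optimalCoupling_le_transportCost h₂ le_rfl hp) hp0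

theorem velocityDist_two (h₁ : IsStickyMotion m x₁ v₁) (h₂ : IsStickyMotion m x₂ v₂)
    {t : ℝ} (ht : 0 ≤ t) :
    velocityDist 2 (motionState m x₁ v₁ t) (motionState m x₂ v₂ t) =
      ENNReal.ofReal √(∑ i, m i * (v₁ i t - v₂ i t) ^ 2) := by
  rw [velocityDist, h₁.optimalCoupling_motionState h₂ ht, lintegral_discreteMeasure]
  simp only [h₁.velocity_motionState ht, h₂.velocity_motionState ht]
  exact sum_ofReal_rpow_two (fun i => (h₁.mass_pos i).le) _

theorem ofReal_le_wasserstein_two (h₁ : IsStickyMotion m x₁ v₁) (h₂ : IsStickyMotion m x₂ v₂)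
    {t : ℝ} (ht : 0 ≤ t) :
    ENNReal.ofReal √(∑ i, m i * (x₁ i t - x₂ i t) ^ 2) ≤
      wasserstein 2 (motionState m x₁ v₁ t).density (motionState m x₂ v₂ t).density := by
  have h := h₁.lintegral_optimalCoupling_le_transportCost h₂ ht one_le_two
  rw [h₁.optimalCoupling_motionState h₂ ht, lintegral_discreteMeasure] at h
  rw [← sum_ofReal_rpow_two fun i => (h₁.mass_pos i).le]
  exact ENNReal.rpow_le_rpow h (by norm_num)

theorem ofReal_le_moment_two (h : IsStickyMotion m x v) {t : ℝ} (ht : 0 ≤ t) :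
    ENNReal.ofReal √(∑ i, m i * v i t ^ 2) ≤ moment 2 (motionState m x v t) := by
  rw [← sum_ofReal_rpow_two (fun i => (h.mass_pos i).le) (fun i => v i t), moment]
  refine ENNReal.rpow_le_rpow ?_ (by norm_num)
  rw [motionState, discreteState_density, lintegral_discreteMeasure]
  refine Finset.sum_le_sum fun i _ => ?_
  gcongr
  have := h.velocity_motionState ht i
  rw [motionState] at this
  rw [this]
  exact le_add_of_nonneg_left (by positivity)

theorem lintegral_velocityDist_le (h₁ : IsStickyMotion m x₁ v₁) (h₂ : IsStickyMotion m x₂ v₂)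
    {t : ℝ} (ht : 0 ≤ t) :
    ∫⁻ r in Ioc 0 t, (velocityDist 2 (motionState m x₁ v₁ r) (motionState m x₂ v₂ r)) ^ 2 ≤
      7 * ENNReal.ofReal (1 + t) *
        (moment 2 (motionState m x₁ v₁ 0) + moment 2 (motionState m x₂ v₂ 0)) *
        (wasserstein 2 (motionState m x₁ v₁ 0).density (motionState m x₂ v₂ 0).density +
          velocityDist 2 (motionState m x₁ v₁ 0) (motionState m x₂ v₂ 0)) := by
  have e : ∫⁻ r in Ioc 0 t, (velocityDist 2 (motionState m x₁ v₁ r) (motionState m x₂ v₂ r)) ^ 2 =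
      ∫⁻ r in Ioc 0 t, ENNReal.ofReal (∑ i, m i * (v₁ i r - v₂ i r) ^ 2) := by
    refine setLIntegral_congr_fun measurableSet_Ioc fun r hr => ?_
    rw [h₁.velocityDist_two h₂ hr.1.le, ← ENNReal.ofReal_pow (Real.sqrt_nonneg _),
      Real.sq_sqrt (Finset.sum_nonneg fun i _ => mul_nonneg (h₁.mass_pos i).le (sq_nonneg _))]
  rw [e, h₁.velocityDist_two h₂ le_rfl]
  refine (h₁.lintegral_velocity_le h₂ ht).trans ?_
  rw [ENNReal.ofReal_mul (by positivity), ENNReal.ofReal_mul (by positivity),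
    ENNReal.ofReal_mul (by norm_num), ENNReal.ofReal_add (Real.sqrt_nonneg _) (Real.sqrt_nonneg _),
    ENNReal.ofReal_add (Real.sqrt_nonneg _) (Real.sqrt_nonneg _), ENNReal.ofReal_ofNat]
  gcongr
  · exact h₁.ofReal_le_moment_two le_rfl
  · exact h₂.ofReal_le_moment_two le_rfl
  · exact h₁.ofReal_le_wasserstein_two h₂ le_rfl

end IsStickyMotion

end StickyParticles

theorem theorem2p2 :
    ∃ C : ℝ≥0, ∀ μ₁ μ₂ : ℝ → StickyParticles.PhaseState,
      StickyParticles.IsStickySolution μ₁ → StickyParticles.IsStickySolution μ₂ →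
      ∀ t : ℝ, 0 ≤ t →
        (∀ ψ : ℝ → ℝ≥0∞, StickyParticles.IsConvexCost ψ →
          StickyParticles.transportCost ψ (μ₁ t).density (μ₂ t).density ≤
            ∫⁻ z, ψ ((z.1 + t * (μ₁ 0).velocity z.1) - (z.2 + t * (μ₂ 0).velocity z.2))
              ∂(StickyParticles.optimalCoupling (μ₁ 0).density (μ₂ 0).density)) ∧
        (∀ p : ℝ, 1 ≤ p →
          StickyParticles.wasserstein p (μ₁ t).density (μ₂ t).density ≤
            StickyParticles.wasserstein p (μ₁ 0).density (μ₂ 0).density +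
              ENNReal.ofReal t * StickyParticles.velocityDist p (μ₁ 0) (μ₂ 0)) ∧
        ∫⁻ r in Ioc 0 t, (StickyParticles.velocityDist 2 (μ₁ r) (μ₂ r)) ^ 2 ≤
          (C : ℝ≥0∞) * ENNReal.ofReal (1 + t) *
            (StickyParticles.moment 2 (μ₁ 0) + StickyParticles.moment 2 (μ₂ 0)) *
            (StickyParticles.wasserstein 2 (μ₁ 0).density (μ₂ 0).density +
              StickyParticles.velocityDist 2 (μ₁ 0) (μ₂ 0)) := by
  refine ⟨7, fun μ₁ μ₂ hμ₁ hμ₂ t ht => ?_⟩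
  obtain ⟨N, m, x₁, v₁, x₂, v₂, h₁, h₂, e₁, e₂⟩ := StickyParticles.exists_common_masses hμ₁ hμ₂
  have e : ∫⁻ r in Ioc 0 t, (StickyParticles.velocityDist 2 (μ₁ r) (μ₂ r)) ^ 2 =
      ∫⁻ r in Ioc 0 t, (StickyParticles.velocityDist 2 (StickyParticles.motionState m x₁ v₁ r)
        (StickyParticles.motionState m x₂ v₂ r)) ^ 2 :=
    setLIntegral_congr_fun measurableSet_Ioc fun r hr => by
      simp only [e₁ r hr.1.le, e₂ r hr.1.le, StickyParticles.motionState]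
  rw [e, e₁ t ht, e₂ t ht, e₁ 0 le_rfl, e₂ 0 le_rfl]
  exact ⟨fun ψ hψ => h₁.transportCost_le h₂ ht hψ, fun p hp => h₁.wasserstein_le h₂ ht hp,
    h₁.lintegral_velocityDist_le h₂ ht⟩
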